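/- Let $n\ge 2$, let $\Lambda=\mathbb{Z}^n$ with the lexicographic order, and let $\Lambda^+=\{a\in\Lambda: a>0\}$. Let $\partial\Lambda^+$ be the set of lexicographically positive tuples $(k_1,\dots,k_{n-1},\infty)$ with $k_i\in\mathbb{Z}\cup\{\infty\}$ such that $k_i=\infty$ implies $k_{i+1}=\infty$. Let $G_1,G_2$ be two copies of $\Lambda^+$ and $\partial G_1,\partial G_2$ the corresponding copies of $\partial\Lambda^+$. Let $X=G_1*G_2$ be the set of finite words $a_1a_2\cdots a_d$ ($d\ge 0$) whose letters lie alternately in $G_1$ and $G_2$, with length $l(a_1\cdots a_d)=\sum_i a_i\in\Lambda$. Let $\partial X$ be the set of infinite alternating words together with the finite alternating sequences $a_1\cdots a_d$ ($d\ge1$) with $a_1,\dots,a_{d-1}$ in $G_1\cup G_2$ and $a_d$ in $\partial G_1\cup\partial G_2$. For $p\in X$ and $x\in\partial X$, the product $px\in\partial X$ is the concatenation, where the last letter of $p$ and the first entry of $x$ are added (componentwise) if they carry the same index. Put $V(p)=\{px:x\in\partial X\}$, give $\partial X$ the topology with base $\mathcal{E}=\{V(p)\}\cup\{V(p)\setminus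 V(q)\}$ ($p,q\in X$), and let $\mathcal{G}$ be the groupoid of all triples $(x,k,y)\in\partial X\times\Lambda\times\partial X$ for which there are $p,q\in X$, $z\in\partial X$ with $x=pz$, $y=qz$, $k=l(p)-l(q)$, with operations $(x,k,y)(y,m,z)=(x,k+m,z)$, $(x,k,y)^{-1}=(y,-k,x)$, and with the (locally compact, Hausdorff, $r$-discrete) topology whose base consists of the sets $[p,q]_A=\{(px,l(p)-l(q),qx):x\in A\}$, $p,q\in X$, $A\in\mathcal{E}$. Let $\mathcal{G}_0=\{(x,0,y)\in\mathcal{G}\}$ with the relative topology, and let $C^*(\mathcal{G}_0)$ be its groupoid $C^*$-algebra, that is, the completion of the convolution $*$-algebra $C_c(\mathcal{G}_0)$ in the norm $\|f\|=\sup_L\|L(f)\|$, where $L$ runs over all nondegenerate $*$-representations of $C_c(\mathcal{G}_0)$ on Hilbert spaces that are bounded by the $I$-norm $$\|f\|_I=\max\Big(\sup_x\sum_{r(\gamma)=x}|f(\gamma)|,\ \sup_x\sum_{s(\gamma)=x}|f(\gamma)|\Big).$$ Then $C^*(\mathcal{G}_0)$ is an AF algebra: it is the closure of the union of an increasing sequence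 of finite-dimensional $C^*$-subalgebras. -/

import Mathlib

open scoped ENNReal CompactlySupported

noncomputable section

namespace ZnTree

/-! ### Words and boundary points of the `ℤⁿ`-tree -/

/-- The group `Λ = ℤⁿ` with the lexicographic order. -/
abbrev Lam (n : ℕ) : Type := Lex (Fin n → ℤ)

/-- `Λ⁺`, the (strictly) positive elements of `Λ`. -/
def Pos (n : ℕ) : Type := {a : Lam n // 0 < a}

/-- The boundary `∂Λ⁺`: the lexicographically positive tuples `(b₁, …, bₙ₋₁, ∞)` with
`bᵢ ∈ ℤ ∪ {∞}` such that `bᵢ = ∞` implies `bᵢ₊₁ = ∞`. -/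
def BdPos (n : ℕ) : Type :=
  {b : Fin n → WithTop ℤ // 0 < toLex b ∧ (∀ i : Fin n, (i : ℕ) + 1 = n → b i = ⊤) ∧
    ∀ i j : Fin n, i ≤ j → b i = ⊤ → b j = ⊤}

/-- Letters of the free product `G₁ * G₂` of two copies of `Λ⁺`; the first component records the
copy. -/
abbrev Letter (n : ℕ) : Type := Bool × Pos n

/-- The set `X = G₁ * G₂` of finite alternating words, including the empty word. -/
def Word (n : ℕ) : Type := {w : List (Letter n) // (w.map Prod.fst).IsChain (· ≠ ·)}

/-- The boundary `∂X`: finite alternating sequences whose last entry (and only this one) lies in a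
copy of `∂Λ⁺`, and infinite alternating sequences of letters. -/
inductive Bd (n : ℕ) : Type
  | fin (w : List (Letter n)) (i : Bool) (b : BdPos n)
      (h : (w.map Prod.fst ++ [i]).IsChain (· ≠ ·)) : Bd n
  | inf (w : ℕ → Letter n) (h : ∀ m, (w m).1 ≠ (w (m + 1)).1) : Bd n

variable {n : ℕ}

/-- Addition in `Λ⁺`. -/
def Pos.add (a b : Pos n) : Pos n := ⟨a.1 + b.1, add_pos a.2 b.2⟩

theorem add_bdPos_pos (a : Lam n) (b : Fin n → WithTop ℤ) (ha : 0 < a) (hb : 0 < toLex b) :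
    0 < toLex (fun i => (ofLex a i : WithTop ℤ) + b i) := by
  obtain ⟨i, hi, hi'⟩ := ha
  obtain ⟨j, hj, hj'⟩ := hb
  replace hi : ∀ k < i, 0 = ofLex a k := hi
  replace hi' : 0 < ofLex a i := hi'
  replace hj : ∀ k < j, 0 = b k := hj
  replace hj' : 0 < b j := hj'
  refine ⟨min i j, fun k hk => ?_, ?_⟩
  · change (0 : WithTop ℤ) = ((ofLex a k : ℤ) : WithTop ℤ) + b k
    rw [← hi k (lt_of_lt_of_le hk (min_le_left _ _)), ← hj k (lt_of_lt_of_le hk (min_le_right _ _))]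
    simp
  · change (0 : WithTop ℤ) < ((ofLex a (min i j) : ℤ) : WithTop ℤ) + b (min i j)
    rcases lt_trichotomy i j with h | h | h
    · rw [min_eq_left h.le, ← hj i h, add_zero]
      exact_mod_cast hi'
    · subst h
      rw [min_self]
      have : (0 : WithTop ℤ) < (ofLex a i : WithTop ℤ) := by exact_mod_cast hi'
      exact lt_of_lt_of_le this (le_add_of_nonneg_right hj'.le)
    · rw [min_eq_right h.le, ← hi j h]
      simpa using hj'

/-- Componentwise addition `Λ⁺ × ∂Λ⁺ → ∂Λ⁺`. -/
def Pos.addBd (a : Pos n) (b : BdPos n) : BdPos n :=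
  ⟨fun i => (ofLex a.1 i : WithTop ℤ) + b.1 i,
    add_bdPos_pos a.1 b.1 a.2 b.2.1,
    fun i hi => WithTop.add_eq_top.2 (Or.inr (b.2.2.1 i hi)),
    fun i j hij hi => by
      rcases WithTop.add_eq_top.1 hi with h | h
      · exact absurd h WithTop.coe_ne_top
      · exact WithTop.add_eq_top.2 (Or.inr (b.2.2.2 i j hij h))⟩

/-- Left multiplication of a boundary point by one letter: if the first entry of the boundary point
lies in the same copy as the letter, the two are added, and otherwise the letter is put in front. -/
def letterMul (u : Letter n) : Bd n → Bd n
  | .fin [] i b h =>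
      if hu : u.1 = i then .fin [] i (u.2.addBd b) h else .fin [u] i b (by simp [hu])
  | .fin (v :: w) i b h =>
      if hu : u.1 = v.1 then .fin ((v.1, u.2.add v.2) :: w) i b h
      else .fin (u :: v :: w) i b (by
        simp only [List.map_cons, List.cons_append] at h ⊢
        exact List.isChain_cons_cons.2 ⟨hu, h⟩)
  | .inf w h =>
      if hu : u.1 = (w 0).1 then
        .inf (fun m => if m = 0 then ((w 0).1, u.2.add (w 0).2) else w m) (fun m => by
          rcases m with _ | m
          · simpa using h 0
          · simpa using h (m + 1))
      else .inf (fun m => m.casesOn u w) (fun m => by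
          rcases m with _ | m
          · exact hu
          · exact h m)

/-- The product `px` of `p ∈ X` and `x ∈ ∂X`. (Since `p` is alternating, only its last letter can
be merged with the first entry of `x`.) -/
def Word.mul (p : Word n) (x : Bd n) : Bd n := p.1.foldr letterMul x

/-- The length `l(a₁a₂⋯a_k) = a₁ + ⋯ + a_k` of a word. -/
def Word.length (p : Word n) : Lam n := (p.1.map (fun u => u.2.1)).sum

/-! ### The topology of the boundary -/

/-- The cylinder `V(p) = {px : x ∈ ∂X}`. -/
def V (p : Word n) : Set (Bd n) := Set.range p.mul

/-- The family `ℰ` of the sets `V(p)` and `V(p; q) = V(p) \ V(q)`. -/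
def basicSets (n : ℕ) : Set (Set (Bd n)) :=
  {A | (∃ p, A = V p) ∨ ∃ p q, A = V p \ V q}

instance : TopologicalSpace (Bd n) := TopologicalSpace.generateFrom (basicSets n)

/-! ### The groupoid -/

/-- `x ∼_k y`: there are `p, q ∈ X` and `z ∈ ∂X` with `k = l(p) - l(q)`, `x = pz`, `y = qz`. -/
def TailEquiv (x : Bd n) (k : Lam n) (y : Bd n) : Prop :=
  ∃ (p q : Word n) (z : Bd n), k = p.length - q.length ∧ x = p.mul z ∧ y = q.mul z

/-- The groupoid `𝒢 = {(x, k, y) ∈ ∂X × Λ × ∂X : x ∼_k y}`. -/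
@[ext] structure Gpd (n : ℕ) : Type where
  rng : Bd n
  lag : Lam n
  src : Bd n
  rel : TailEquiv rng lag src

/-- The set `[p, q]_A = {(px, l(p) - l(q), qx) : x ∈ A}`. -/
def bisection (p q : Word n) (A : Set (Bd n)) : Set (Gpd n) :=
  {g | ∃ x ∈ A, g.rng = p.mul x ∧ g.lag = p.length - q.length ∧ g.src = q.mul x}

/-- The topology of `𝒢` generated by the sets `[p, q]_A`, `A ∈ ℰ`. -/
instance : TopologicalSpace (Gpd n) :=
  TopologicalSpace.generateFrom {S | ∃ p q, ∃ A ∈ basicSets n, S = bisection p q A}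

/-- The subgroupoid `𝒢₀ = {(x, 0, y) ∈ 𝒢}`, with the relative topology. -/
abbrev Gpd₀ (n : ℕ) : Type := {g : Gpd n // g.lag = 0}

/-- `γ = αβ` in the groupoid: `(x, k, y)(y, m, z) = (x, k + m, z)`. -/
def IsMul (α β γ : Gpd n) : Prop :=
  α.src = β.rng ∧ γ.rng = α.rng ∧ γ.lag = α.lag + β.lag ∧ γ.src = β.src

/-- The inverse `(x, k, y)⁻¹ = (y, -k, x)`. -/
def Gpd.inv (g : Gpd n) : Gpd n where
  rng := g.src
  lag := -g.lag
  src := g.rng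
  rel := by
    obtain ⟨p, q, z, hk, hx, hy⟩ := g.rel
    exact ⟨q, p, z, by rw [hk, neg_sub], hy, hx⟩

/-- The inverse on the subgroupoid `𝒢₀`. -/
def inv₀ (g : Gpd₀ n) : Gpd₀ n := ⟨g.1.inv, by simp [Gpd.inv, g.2]⟩

/-! ### The convolution algebra `C_c(𝒢₀)` and its representations -/

/-- The convolution `(f * g)(γ) = ∑_{αβ = γ} f(α) g(β)` over `𝒢₀`. For `f` and `g` in `C_c(𝒢₀)`
the sum has finitely many nonzero terms and `f * g` is in `C_c(𝒢₀)` again. -/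
def conv (f g : Gpd₀ n → ℂ) (γ : Gpd₀ n) : ℂ :=
  ∑ᶠ ab : {ab : Gpd₀ n × Gpd₀ n // IsMul ab.1.1 ab.2.1 γ.1}, f ab.1.1 * g ab.1.2

/-- The involution `f*(γ) = conj (f (γ⁻¹))`. -/
def invol (f : Gpd₀ n → ℂ) (γ : Gpd₀ n) : ℂ := starRingEnd ℂ (f (inv₀ γ))

/-- The `I`-norm, the larger one of `sup_x ∑_{r(γ) = x} |f(γ)|` and
`sup_x ∑_{s(γ) = x} |f(γ)|`. -/
def iNorm (f : Gpd₀ n → ℂ) : ℝ≥0∞ :=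
  max (⨆ x : Bd n, ∑' γ : {γ : Gpd₀ n // γ.1.rng = x}, ‖f γ.1‖ₑ)
    (⨆ x : Bd n, ∑' γ : {γ : Gpd₀ n // γ.1.src = x}, ‖f γ.1‖ₑ)

/-- A bounded representation of the convolution `*`-algebra `C_c(𝒢₀)`: a nondegenerate
`*`-homomorphism to the bounded operators of a Hilbert space, bounded for the `I`-norm. That `L`
preserves products and adjoints is said as: `L h = L f * L g` for the element `h = f * g` of
`C_c(𝒢₀)`, and `L g = (L f)*` for the element `g = f*` of `C_c(𝒢₀)`. -/
structure Rep (n : ℕ) : Type 1 where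
  H : Type
  [normed : NormedAddCommGroup H]
  [inner : InnerProductSpace ℂ H]
  [complete : CompleteSpace H]
  L : C_c(Gpd₀ n, ℂ) →ₗ[ℂ] (H →L[ℂ] H)
  map_conv : ∀ f g h : C_c(Gpd₀ n, ℂ), ⇑h = conv f g → L h = L f * L g
  map_invol : ∀ f g : C_c(Gpd₀ n, ℂ), ⇑g = invol f → L g = star (L f)
  nondegenerate : Dense (Submodule.span ℂ {v : H | ∃ f w, v = L f w} : Set H)
  bounded : ∀ f, ‖L f‖ₑ ≤ iNorm f

attribute [instance] Rep.normed Rep.inner Rep.complete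

theorem Pos.add_right_injective (a : Pos n) : Function.Injective a.add := fun b c h =>
  Subtype.ext (add_left_cancel (congrArg Subtype.val h : a.1 + b.1 = a.1 + c.1))

theorem Pos.add_ne_left (a b : Pos n) : a.add b ≠ a := fun h => by
  have h' : a.1 + b.1 = a.1 := congrArg Subtype.val h
  exact b.2.ne' (by simpa using h')

theorem Pos.addBd_injective (a : Pos n) : Function.Injective a.addBd := fun b c h => by
  refine Subtype.ext (funext fun i => ?_)
  have h' : (ofLex a.1 i : WithTop ℤ) + b.1 i = (ofLex a.1 i : WithTop ℤ) + c.1 i :=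
    congrFun (congrArg Subtype.val h) i
  exact WithTop.add_left_cancel WithTop.coe_ne_top h'

theorem letterMul_injective (u : Letter n) : Function.Injective (letterMul u) := by
  obtain ⟨s, a⟩ := u
  intro x y hxy
  have key : ∀ v : Letter n, (s, a) ≠ (v.1, a.add v.2) := fun v h =>
    a.add_ne_left v.2 (congrArg Prod.snd h).symm
  rcases x with ⟨_ | ⟨v, w⟩, i, b, h⟩ | ⟨w, h⟩ <;>
    rcases y with ⟨_ | ⟨v', w'⟩, i', b', h'⟩ | ⟨w', h'⟩ <;>
    simp only [letterMul] at hxy <;> split_ifs at hxy with h1 h2 h2 <;>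
    simp only [Bd.fin.injEq, Bd.inf.injEq, List.cons.injEq, true_and, reduceCtorEq, false_and,
      and_false] at hxy ⊢
  · exact ⟨hxy.1, a.addBd_injective hxy.2⟩
  · exact hxy
  · exact key _ hxy.1.1
  · exact key _ hxy.1.1.symm
  · obtain ⟨⟨hv, hw⟩, hb⟩ := hxy
    exact ⟨⟨Prod.ext (h1.symm.trans h2) (a.add_right_injective (congrArg Prod.snd hv)), hw⟩, hb⟩
  · exact (key _ hxy.1.1.symm).elim
  · exact (key _ hxy.1.1).elim
  · exact hxy
  · funext m
    have hm := congrFun hxy m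
    rcases m with _ | m
    · exact Prod.ext (h1.symm.trans h2) (a.add_right_injective (congrArg Prod.snd hm))
    · exact hm
  · exact (key _ (congrFun hxy 0).symm).elim
  · exact (key _ (congrFun hxy 0)).elim
  · funext m
    exact congrFun hxy (m + 1)

theorem Word.mul_injective (p : Word n) : Function.Injective p.mul := by
  obtain ⟨w, hw⟩ := p
  intro x y h
  change w.foldr letterMul x = w.foldr letterMul y at h
  clear hw
  induction w with
  | nil => exact h
  | cons u w ih => exact ih (letterMul_injective u h)

theorem isOpen_bisection_univ (p q : Word n) :
    IsOpen (Subtype.val ⁻¹' bisection p q Set.univ : Set (Gpd₀ n)) := by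
  refine IsOpen.preimage continuous_subtype_val (TopologicalSpace.isOpen_generateFrom_of_mem ?_)
  refine ⟨p, q, Set.univ, Or.inl ⟨⟨[], List.isChain_nil⟩, ?_⟩, rfl⟩
  exact (Set.eq_univ_of_forall fun x => Set.mem_range.2 ⟨x, rfl⟩).symm

theorem tsum_fibre_le (f : C_c(Gpd₀ n, ℂ)) (π : Gpd₀ n → Bd n)
    (hπ : ∀ p q : Word n, Set.InjOn π (Subtype.val ⁻¹' bisection p q Set.univ)) :
    (⨆ x : Bd n, ∑' γ : {γ : Gpd₀ n // π γ = x}, ‖f γ.1‖ₑ) < ⊤ := by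
  classical
  obtain ⟨C, hC⟩ := f.hasCompactSupport.exists_bound_of_continuous f.continuous
  obtain ⟨t, ht⟩ := f.hasCompactSupport.elim_finite_subcover
    (fun i : Word n × Word n => (Subtype.val ⁻¹' bisection i.1 i.2 Set.univ : Set (Gpd₀ n)))
    (fun i => isOpen_bisection_univ i.1 i.2) (fun γ _ => by
      obtain ⟨p, q, z, h⟩ := γ.1.rel
      exact Set.mem_iUnion.2 ⟨(p, q), z, trivial, h.2.1, h.1, h.2.2⟩)
  have hle : ∀ γ, ‖f γ‖ₑ ≤ ∑ i ∈ t,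
      if γ.1 ∈ bisection i.1 i.2 Set.univ then ENNReal.ofReal C else 0 := fun γ => by
    by_cases h0 : f γ = 0
    · simp [h0]
    obtain ⟨i, hi⟩ := Set.mem_iUnion.1 (ht (subset_tsupport f h0))
    obtain ⟨hit, hi⟩ := Set.mem_iUnion.1 hi
    refine le_trans ?_ (Finset.single_le_sum (fun _ _ => zero_le) hit)
    rw [if_pos (show γ.1 ∈ bisection i.1 i.2 Set.univ from hi), ← ofReal_norm]
    exact ENNReal.ofReal_le_ofReal (hC γ)
  refine lt_of_le_of_lt (b := ∑ i ∈ t, ENNReal.ofReal C) (iSup_le fun x => ?_)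
    (ENNReal.sum_lt_top.2 fun _ _ => ENNReal.ofReal_lt_top)
  refine (ENNReal.tsum_le_tsum fun γ : {γ : Gpd₀ n // π γ = x} => hle γ.1).trans ?_
  rw [Summable.tsum_finsetSum fun _ _ => ENNReal.summable]
  refine Finset.sum_le_sum fun i _ => ?_
  by_cases h : ∃ γ : {γ : Gpd₀ n // π γ = x}, γ.1.1 ∈ bisection i.1 i.2 Set.univ
  · obtain ⟨γ, hγ⟩ := h
    rw [tsum_eq_single γ fun γ' hne => if_neg
      fun hγ' : γ'.1.1 ∈ bisection i.1 i.2 Set.univ =>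
        hne (Subtype.ext (hπ i.1 i.2 hγ' hγ (γ'.2.trans γ.2.symm)))]
    exact (if_pos hγ).le
  · rw [ENNReal.tsum_eq_zero.2 fun γ => if_neg fun hγ => h ⟨γ, hγ⟩]
    exact zero_le

theorem iNorm_lt_top (f : C_c(Gpd₀ n, ℂ)) : iNorm f < ⊤ := by
  refine max_lt (tsum_fibre_le f (fun γ => γ.1.rng) ?_) (tsum_fibre_le f (fun γ => γ.1.src) ?_) <;>
    rintro p q γ ⟨x, -, h1, h2, h3⟩ γ' ⟨x', -, h1', h2', h3'⟩ h
  · have hx : x = x' := p.mul_injective (h1.symm.trans (h.trans h1'))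
    subst hx
    exact Subtype.ext (Gpd.ext h (h2.trans h2'.symm) (h3.trans h3'.symm))
  · have hx : x = x' := q.mul_injective (h3.symm.trans (h.trans h3'))
    subst hx
    exact Subtype.ext (Gpd.ext (h1.trans h1'.symm) (h2.trans h2'.symm) h)

/-! ### The `C*`-algebra of `𝒢₀` -/

/-- The universal representation of `C_c(𝒢₀)`, the direct sum of all bounded representations. Its
norm is `f ↦ sup_L ‖L f‖`. -/
def univRep (f : C_c(Gpd₀ n, ℂ)) : lp (fun ρ : Rep n => ρ.H →L[ℂ] ρ.H) ∞ :=
  ⟨fun ρ => ρ.L f, memℓp_infty ⟨(iNorm f).toReal, by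
    rintro _ ⟨ρ, rfl⟩
    have := ENNReal.toReal_mono (iNorm_lt_top f).ne (ρ.bounded f)
    simpa using this⟩⟩

/-- `C*(𝒢₀)`: the completion of `C_c(𝒢₀)` for the norm `f ↦ sup_L ‖L f‖`, realised as the closed
`*`-algebra generated by the image of `C_c(𝒢₀)` under the universal representation. -/
def cstar (n : ℕ) : NonUnitalStarSubalgebra ℂ (lp (fun ρ : Rep n => ρ.H →L[ℂ] ρ.H) ∞) :=
  (NonUnitalStarAlgebra.adjoin ℂ (Set.range (univRep (n := n)))).topologicalClosure

instance : IsClosed (cstar n : Set (lp (fun ρ : Rep n => ρ.H →L[ℂ] ρ.H) ∞)) :=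
  NonUnitalStarSubalgebra.isClosed_topologicalClosure _

/-- An AF algebra: the closure of the union of an increasing sequence of finite-dimensional
`C*`-subalgebras. -/
def IsAF (A : Type*) [NonUnitalCStarAlgebra A] : Prop :=
  ∃ F : ℕ → NonUnitalStarSubalgebra ℂ A, Monotone F ∧ (∀ m, FiniteDimensional ℂ (F m)) ∧
    Dense (⋃ m, (F m : Set A))

end ZnTree

end

open scoped ENNReal CompactlySupported

noncomputable section

namespace ZnTree

variable {n : ℕ}

/-! ### The product of words -/

/-! The words form a monoid that acts injectively on `∂X` and on which the length is additive. If
`px = qy`, then one of `p`, `q` is a prefix of the other (`Word.comparable`), so cylinders are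
nested or disjoint. The same holds for the bisections `[p, q]` with `l(p) = l(q)`, which cover `𝒢₀`
and generate its topology. Their indicator functions multiply like matrix units: `[p, q][qt, s] =
[pt, s]`, `[p, rt][r, s] = [p, st]`, and all other products vanish.

Hence the indicators of `[p, q]` with `p, q ∈ F` span a `*`-algebra as soon as `F` is closed under
exchanging prefixes of equal length. The combinatorial core, `exists_exchangeClosed`, is that every
finite set of words lies in a finite set of this kind. As there are countably many words, this gives
an increasing sequence of finite-dimensional `*`-algebras containing every indicator.

Density of their union rests on compactness of `∂X`. The words whose cylinders belong to an
ultrafilter form a chain, and such a chain consists of the prefixes of a boundary point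
(`exists_point_of_chain`); the entries `∞` of `∂Λ⁺` are what represents cuts of `Λ` without a
maximum (`exists_cut`). So each `[p, q]` is a compact open bisection. A function in `C_c(𝒢₀)` is
supported in finitely many of them, where it is uniformly approximated by combinations of
indicators. The `I`-norm of the error is at most its supremum times the number of bisections
(`exists_iNorm_approx`), and the norm of `C*(𝒢₀)` is dominated by the `I`-norm. -/

theorem Pos.add_assoc (a b c : Pos n) : (a.add b).add c = a.add (b.add c) :=
  Subtype.ext (_root_.add_assoc a.1 b.1 c.1)

theorem Pos.add_addBd (a b : Pos n) (c : BdPos n) : (a.add b).addBd c = a.addBd (b.addBd c) := by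
  refine Subtype.ext (funext fun i => ?_)
  change ((ofLex (a.1 + b.1) i : ℤ) : WithTop ℤ) + c.1 i
    = (ofLex a.1 i : WithTop ℤ) + ((ofLex b.1 i : WithTop ℤ) + c.1 i)
  rw [← _root_.add_assoc]
  rfl

/-- The difference of two positive elements. -/
def Pos.sub (b a : Pos n) (h : a.1 < b.1) : Pos n := ⟨b.1 - a.1, sub_pos.2 h⟩

theorem Pos.add_sub_cancel (a b : Pos n) (h : a.1 < b.1) : a.add (b.sub a h) = b :=
  Subtype.ext (_root_.add_sub_cancel a.1 b.1)

/-- The copy in which the first entry of a boundary point lies. -/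
def Bd.head : Bd n → Bool
  | .fin [] i _ _ => i
  | .fin (v :: _) _ _ _ => v.1
  | .inf w _ => (w 0).1

theorem head_letterMul (u : Letter n) (x : Bd n) : (letterMul u x).head = u.1 := by
  rcases x with ⟨_ | ⟨v, w⟩, i, b, h⟩ | ⟨w, h⟩ <;> simp only [letterMul] <;> split_ifs with h1 <;>
    simp [Bd.head, h1]

/-- Merging two letters of one copy before or after acting makes no difference: `letterMul (s, b) x`
starts in copy `s`, so `(s, a)` is always absorbed into its first entry. This is what makes the
product of words act. -/
theorem letterMul_add (s : Bool) (a b : Pos n) (x : Bd n) :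
    letterMul (s, a.add b) x = letterMul (s, a) (letterMul (s, b) x) := by
  rcases x with ⟨_ | ⟨v, w⟩, i, c, h⟩ | ⟨w, h⟩
  · by_cases h1 : s = i
    · simp [letterMul, h1, Pos.add_addBd]
    · simp [letterMul, h1]
  · by_cases h1 : s = v.1
    · simp [letterMul, h1, Pos.add_assoc]
    · simp [letterMul, h1]
  · by_cases h1 : s = (w 0).1
    · simp only [letterMul, h1, dif_pos, if_pos, Bd.inf.injEq]
      funext m
      rcases m with _ | m
      · simp [Pos.add_assoc]
      · simp
    · simp only [letterMul, h1, dif_neg, not_false_eq_true]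
      refine Eq.symm ((dif_pos rfl).trans ?_)
      rw [Bd.inf.injEq]
      funext m
      rcases m with _ | m
      · simp
      · simp

/-- Left multiplication of a list of letters by one letter. -/
def consMul (u : Letter n) : List (Letter n) → List (Letter n)
  | [] => [u]
  | v :: w => if u.1 = v.1 then (v.1, u.2.add v.2) :: w else u :: v :: w

/-- A list of letters is alternating if consecutive letters lie in different copies. -/
abbrev Alt (w : List (Letter n)) : Prop := (w.map Prod.fst).IsChain (· ≠ ·)

theorem alt_consMul (u : Letter n) {w : List (Letter n)} (hw : Alt w) : Alt (consMul u w) := by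
  rcases w with _ | ⟨v, w⟩
  · simp [consMul, Alt]
  · simp only [consMul]
    split_ifs with h
    · exact hw
    · exact List.isChain_cons_cons.2 ⟨h, hw⟩

theorem consMul_of_alt {u : Letter n} {w : List (Letter n)} (hw : Alt (u :: w)) :
    consMul u w = u :: w := by
  rcases w with _ | ⟨v, w⟩
  · rfl
  · exact if_neg (List.isChain_cons_cons.1 hw).1

theorem letterMul_consMul (u : Letter n) (w : List (Letter n)) (x : Bd n) :
    (consMul u w).foldr letterMul x = letterMul u (w.foldr letterMul x) := by
  rcases w with _ | ⟨v, w⟩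
  · rfl
  · simp only [consMul]
    split_ifs with h
    · obtain ⟨s, a⟩ := u
      obtain ⟨t, b⟩ := v
      obtain rfl : s = t := h
      exact letterMul_add s a b _
    · rfl

theorem sum_consMul (u : Letter n) (w : List (Letter n)) :
    ((consMul u w).map (fun u => u.2.1)).sum = u.2.1 + (w.map (fun u => u.2.1)).sum := by
  rcases w with _ | ⟨v, w⟩
  · rfl
  · simp only [consMul]
    split_ifs with h
    · simp [Pos.add, _root_.add_assoc]
    · rfl

theorem foldr_consMul_of_alt {p w : List (Letter n)} (h : Alt (p ++ w)) :
    p.foldr consMul w = p ++ w := by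
  induction p with
  | nil => rfl
  | cons u p ih =>
    rw [List.foldr_cons, ih (List.IsChain.tail h)]
    exact consMul_of_alt h

/-- The empty word. -/
def Word.nil : Word n := ⟨[], List.isChain_nil⟩

/-- The product of two words. -/
def Word.app (p q : Word n) : Word n := ⟨p.1.foldr consMul q.1, by
  induction p.1 with
  | nil => exact q.2
  | cons u p ih => exact alt_consMul u ih⟩

theorem Word.app_mul (p q : Word n) (x : Bd n) : (p.app q).mul x = p.mul (q.mul x) := by
  obtain ⟨p, hp⟩ := p
  change (p.foldr consMul q.1).foldr letterMul x = p.foldr letterMul (q.1.foldr letterMul x)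
  clear hp
  induction p with
  | nil => rfl
  | cons u p ih => rw [List.foldr_cons, letterMul_consMul, ih, List.foldr_cons]

theorem Word.length_app (p q : Word n) : (p.app q).length = p.length + q.length := by
  obtain ⟨p, hp⟩ := p
  change ((p.foldr consMul q.1).map _).sum = (p.map _).sum + (q.1.map _).sum
  clear hp
  induction p with
  | nil => simp
  | cons u p ih => rw [List.foldr_cons, sum_consMul, ih, List.map_cons, List.sum_cons, add_assoc]

theorem Word.nil_app (p : Word n) : Word.nil.app p = p := rfl

theorem Word.app_nil (p : Word n) : p.app Word.nil = p :=
  Subtype.ext ((foldr_consMul_of_alt (w := []) (by simpa using p.2)).trans (List.append_nil _))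

theorem Word.length_nonneg (p : Word n) : 0 ≤ p.length :=
  List.sum_nonneg fun a ha => by
    obtain ⟨u, -, rfl⟩ := List.mem_map.1 ha
    exact u.2.2.le

theorem Word.eq_nil_of_length_eq_zero {p : Word n} (h : p.length = 0) : p = Word.nil := by
  obtain ⟨_ | ⟨u, p⟩, hp⟩ := p
  · rfl
  · have h1 : u.2.1 + Word.length ⟨p, hp.tail⟩ = 0 := h
    exact absurd h1 (add_pos_of_pos_of_nonneg u.2.2 (Word.length_nonneg _)).ne'

theorem head_foldr_letterMul {v : Letter n} {p : List (Letter n)} {x : Bd n} :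
    Bd.head ((v :: p).foldr letterMul x) = v.1 := head_letterMul _ _

/-- Cancelling `(s, a)` leaves a point starting in copy `s` on the right. If `p` were nonempty,
alternation would make the left side start in the other copy; so `p` is empty and the remainder
begins with `b - a`. -/
theorem foldr_letterMul_eq_of_lt {s : Bool} {a b : Pos n} {p q : List (Letter n)} {x y : Bd n}
    (hp : Alt ((s, a) :: p)) (hq : Alt ((s, b) :: q)) (hab : a.1 < b.1)
    (h : ((s, a) :: p).foldr letterMul x = ((s, b) :: q).foldr letterMul y) :
    ∃ t : Word n, (s, b) :: q = ((s, a) :: p).foldr consMul t.1 ∧ x = t.mul y := by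
  have h1 : p.foldr letterMul x = letterMul (s, b.sub a hab) (q.foldr letterMul y) := by
    refine letterMul_injective (s, a) ?_
    rw [← letterMul_add, Pos.add_sub_cancel]
    exact h
  rcases p with _ | ⟨v, p⟩
  · refine ⟨⟨(s, b.sub a hab) :: q, hq⟩, ?_, h1⟩
    simp [consMul, Pos.add_sub_cancel]
  · have h2 := congrArg Bd.head h1
    rw [head_foldr_letterMul, head_letterMul] at h2
    exact absurd h2.symm (List.isChain_cons_cons.1 hp).1

/-- Two words acting with a common value are comparable. -/
theorem Word.comparable {p q : Word n} {x y : Bd n} (h : p.mul x = q.mul y) :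
    (∃ t : Word n, q = p.app t ∧ x = t.mul y) ∨ ∃ t : Word n, p = q.app t ∧ y = t.mul x := by
  obtain ⟨p, hp⟩ := p
  obtain ⟨q, hq⟩ := q
  induction p generalizing q with
  | nil => exact Or.inl ⟨⟨q, hq⟩, rfl, h⟩
  | cons u p ih =>
    rcases q with _ | ⟨v, q⟩
    · exact Or.inr ⟨⟨u :: p, hp⟩, rfl, h.symm⟩
    have huv : u.1 = v.1 :=
      head_foldr_letterMul.symm.trans ((congrArg Bd.head h).trans head_foldr_letterMul)
    obtain ⟨s, a⟩ := u
    obtain ⟨s', b⟩ := v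
    obtain rfl : s = s' := huv
    rcases lt_trichotomy a.1 b.1 with hab | hab | hab
    · obtain ⟨t, h1, h2⟩ := foldr_letterMul_eq_of_lt hp hq hab h
      exact Or.inl ⟨t, Subtype.ext h1, h2⟩
    · obtain rfl : a = b := Subtype.ext hab
      rcases ih hp.tail q hq.tail (letterMul_injective _ h) with ⟨t, h1, h2⟩ | ⟨t, h1, h2⟩
      · refine Or.inl ⟨t, Subtype.ext ?_, h2⟩
        have h3 : q = p.foldr consMul t.1 := congrArg Subtype.val h1
        change _ = consMul _ (p.foldr consMul t.1)
        rw [← h3, consMul_of_alt hq]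
      · refine Or.inr ⟨t, Subtype.ext ?_, h2⟩
        have h3 : p = q.foldr consMul t.1 := congrArg Subtype.val h1
        change _ = consMul _ (q.foldr consMul t.1)
        rw [← h3, consMul_of_alt hp]
    · obtain ⟨t, h1, h2⟩ := foldr_letterMul_eq_of_lt hq hp hab h.symm
      exact Or.inr ⟨t, Subtype.ext h1, h2⟩

/-- The words are comparable and the quotient has length zero, hence is empty. Identities between
words can thus be checked on lengths and on a single boundary point. -/
theorem Word.eq_of_mul_eq {p q : Word n} {x y : Bd n} (h : p.mul x = q.mul y)
    (hl : p.length = q.length) : p = q := by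
  rcases Word.comparable h with ⟨t, rfl, -⟩ | ⟨t, rfl, -⟩ <;> rw [Word.length_app] at hl
  · rw [Word.eq_nil_of_length_eq_zero (left_eq_add.1 hl), Word.app_nil]
  · rw [Word.eq_nil_of_length_eq_zero (add_eq_left.1 hl), Word.app_nil]

/-- The least positive element `(0, …, 0, 1)`. -/
def Pos.one [NeZero n] : Pos n :=
  ⟨toLex (Pi.single (Fin.rev 0) 1), (Fin.rev 0 : Fin n), fun j _ => by
    rcases eq_or_ne j (Fin.rev 0) with rfl | h
    · exact absurd ‹_› (lt_irrefl _)
    · exact (Pi.single_eq_of_ne (M := fun _ => ℤ) h 1).symm, by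
    change (0 : ℤ) < Pi.single (M := fun _ => ℤ) (Fin.rev 0) 1 (Fin.rev 0)
    simp⟩

instance [NeZero n] : Nonempty (Bd n) :=
  ⟨.inf (fun m => (m.bodd, Pos.one)) fun m => by simp⟩

/-! ### Cancellation in the monoid of words and finite exchange-closed sets -/

section Assoc

variable [NeZero n]

theorem Word.app_assoc (p q r : Word n) : (p.app q).app r = p.app (q.app r) := by
  obtain ⟨x⟩ := (inferInstance : Nonempty (Bd n))
  exact Word.eq_of_mul_eq (x := x) (y := x) (by simp only [Word.app_mul])
    (by simp only [Word.length_app, add_assoc])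

theorem Word.app_left_cancel {p t s : Word n} (h : p.app t = p.app s) : t = s := by
  obtain ⟨x⟩ := (inferInstance : Nonempty (Bd n))
  refine Word.eq_of_mul_eq (x := x) (y := x) (p.mul_injective ?_) ?_
  · rw [← Word.app_mul, ← Word.app_mul, h]
  · have := congrArg Word.length h
    rwa [Word.length_app, Word.length_app, add_right_inj] at this

theorem Word.comparable_of_app_eq {p q t s : Word n} (h : p.app t = q.app s) :
    (∃ u : Word n, q = p.app u ∧ t = u.app s) ∨ ∃ u : Word n, p = q.app u ∧ s = u.app t := by
  obtain ⟨x⟩ := (inferInstance : Nonempty (Bd n))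
  have hx : p.mul (t.mul x) = q.mul (s.mul x) := by rw [← Word.app_mul, ← Word.app_mul, h]
  rcases Word.comparable hx with ⟨u, rfl, -⟩ | ⟨u, rfl, -⟩
  · exact Or.inl ⟨u, rfl, Word.app_left_cancel (h.trans (Word.app_assoc _ _ _))⟩
  · exact Or.inr ⟨u, rfl, Word.app_left_cancel (h.symm.trans (Word.app_assoc _ _ _))⟩

/-- A set of words is closed under the exchange of prefixes of equal length. -/
def ExchangeClosed (F : Set (Word n)) : Prop :=
  ∀ p ∈ F, ∀ q ∈ F, ∀ t, q.app t ∈ F → p.length = q.length → p.app t ∈ F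

/-- Write `w = qt` with `q` the longest prefix of `w` in `F`, and add all `pt` with `p ∈ F`, `l(p) =
l(q)`. The new words have the maximal length `l(w)`, so none of them is a proper prefix of a word of
the enlarged set, and maximality of `q` prevents further exchanges from producing anything new. -/
theorem exists_exchangeClosed_insert (F : Finset (Word n)) (hnil : Word.nil ∈ F)
    (hF : ExchangeClosed (F : Set (Word n))) (w : Word n) (hw : ∀ p ∈ F, p.length ≤ w.length) :
    ∃ F' : Finset (Word n), F ⊆ F' ∧ w ∈ F' ∧ ExchangeClosed (F' : Set (Word n)) ∧
      ∀ p ∈ F', p.length ≤ w.length := by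
  classical
  obtain ⟨q, hq, hmax⟩ := (F.filter fun q => ∃ t, w = q.app t).exists_max_image Word.length
    ⟨Word.nil, by simp [hnil, Word.nil_app]⟩
  obtain ⟨hqF, t, rfl⟩ := Finset.mem_filter.1 hq
  have hlen : ∀ p : Word n, p.length = q.length → (p.app t).length = (q.app t).length :=
    fun p hp => by rw [Word.length_app, Word.length_app, hp]
  have hnil' : ∀ b s : Word n, (b.app s).length ≤ b.length → s = Word.nil := fun b s h => by
    rw [Word.length_app] at h
    exact Word.eq_nil_of_length_eq_zero
      (le_antisymm ((add_le_iff_nonpos_right _).1 h) s.length_nonneg)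
  let N := (F.filter fun p => p.length = q.length).image fun p => p.app t
  have hN : ∀ r, r ∈ N ↔ ∃ p ∈ F, p.length = q.length ∧ p.app t = r := fun r => by
    simp [N, and_assoc]
  have hle : ∀ p ∈ F ∪ N, p.length ≤ (q.app t).length := fun p hp => by
    rcases Finset.mem_union.1 hp with hp | hp
    · exact hw p hp
    · obtain ⟨p', -, hp', rfl⟩ := (hN p).1 hp
      exact (hlen p' hp').le
  refine ⟨F ∪ N, Finset.subset_union_left, Finset.mem_union_right _ ((hN _).2 ⟨q, hqF, rfl, rfl⟩),
    fun a ha b hb s hbs hab => ?_, hle⟩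
  rw [Finset.mem_coe] at *
  by_cases hs : (b.app s).length ≤ b.length
  · rw [hnil' b s hs, Word.app_nil]
    exact ha
  have hbF : b ∈ F := by
    refine (Finset.mem_union.1 hb).resolve_right fun hb => hs ?_
    obtain ⟨p', -, hp', rfl⟩ := (hN b).1 hb
    rw [hlen p' hp']
    exact hle _ hbs
  have haF : a ∈ F := by
    refine (Finset.mem_union.1 ha).resolve_right fun ha => hs ?_
    obtain ⟨p', -, hp', rfl⟩ := (hN a).1 ha
    rw [← hab, hlen p' hp']
    exact hle _ hbs
  rcases Finset.mem_union.1 hbs with hbs | hbs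
  · exact Finset.mem_union_left _ (hF a haF b hbF s hbs hab)
  obtain ⟨p, hpF, hpq, hps⟩ := (hN _).1 hbs
  rcases Word.comparable_of_app_eq hps with ⟨v, rfl, rfl⟩ | ⟨v, rfl, rfl⟩
  -- Here `b = pv` and `t = vs`. Exchange puts `qv` into `F`, and it is a prefix of `w = qvs`, so
  -- `v` is empty by the choice of `q`.
  · have hqv : q.app v ∈ F := hF q hqF p hpF v hbF hpq.symm
    have h1 := hmax (q.app v) (Finset.mem_filter.2 ⟨hqv, s, (Word.app_assoc _ _ _).symm⟩)
    obtain rfl := hnil' q v h1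
    rw [Word.app_nil] at hab
    exact Finset.mem_union_right _ ((hN _).2 ⟨a, haF, hab.trans hpq, rfl⟩)
  -- Here `p = bv` and `s = vt`, so `as = (av)t`, with `av ∈ F` of the same length as `q`.
  · refine Finset.mem_union_right _ ((hN _).2 ⟨a.app v, hF a haF b hbF v hpF hab, ?_,
      Word.app_assoc _ _ _⟩)
    rw [← hpq, Word.length_app, Word.length_app, hab]

/-- The words are inserted in order of increasing length, starting from the empty word, because the
insertion step needs the new word to be at least as long as all present ones. -/
theorem exists_exchangeClosed (F : Finset (Word n)) :
    ∃ F' : Finset (Word n), F ⊆ F' ∧ ExchangeClosed (F' : Set (Word n)) := by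
  classical
  suffices h : ∃ F' : Finset (Word n), F ⊆ F' ∧ ExchangeClosed (F' : Set (Word n)) ∧
      Word.nil ∈ F' ∧ ∀ p ∈ F', p = Word.nil ∨ ∃ q ∈ F, p.length ≤ q.length from
    h.imp fun F' h => ⟨h.1, h.2.1⟩
  refine Finset.induction_on_max_value Word.length F ?_ fun w F _ hmax ih => ?_
  · refine ⟨{Word.nil}, by simp, fun p hp q hq t ht _ => ?_, by simp, by simp⟩
    simp only [Finset.coe_singleton, Set.mem_singleton_iff] at *
    subst hp hq
    exact ht
  · obtain ⟨F', hFF', hF', hnil, hle⟩ := ih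
    obtain ⟨F'', h1, h2, h3, h4⟩ := exists_exchangeClosed_insert F' hnil hF' w fun p hp => by
      rcases hle p hp with rfl | ⟨q, hq, hpq⟩
      · exact w.length_nonneg
      · exact hpq.trans (hmax q hq)
    exact ⟨F'', Finset.insert_subset h2 (hFF'.trans h1), h3, h1 hnil,
      fun p hp => Or.inr ⟨w, Finset.mem_insert_self _ _, h4 p hp⟩⟩

end Assoc

/-! ### Points of the boundary and chains of words -/

theorem lam_lt_iff {a b : Lam n} :
    a < b ↔ ∃ i, (∀ j < i, ofLex a j = ofLex b j) ∧ ofLex a i < ofLex b i := Iff.rfl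

theorem coe_lt_iff {a : Lam n} {b : Fin n → WithTop ℤ} :
    toLex (fun i => (ofLex a i : WithTop ℤ)) < toLex b ↔
      ∃ i, (∀ j < i, (ofLex a j : WithTop ℤ) = b j) ∧ (ofLex a i : WithTop ℤ) < b i := Iff.rfl

theorem le_rev_zero [NeZero n] (k : Fin n) : k ≤ Fin.rev 0 := by
  rw [← Fin.rev_rev k]
  exact Fin.rev_le_rev.2 (Fin.zero_le _)

theorem Pos.one_apply_of_ne [NeZero n] {k : Fin n} (hk : k ≠ Fin.rev 0) :
    ofLex (Pos.one : Pos n).1 k = 0 := Pi.single_eq_of_ne (M := fun _ => ℤ) hk 1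

theorem Pos.one_apply_rev_zero [NeZero n] : ofLex (Pos.one : Pos n).1 (Fin.rev 0) = 1 :=
  Pi.single_eq_same (M := fun _ => ℤ) _ _

theorem Pos.one_le [NeZero n] (a : Pos n) : Pos.one.1 ≤ a.1 := by
  by_contra hlt
  obtain ⟨j, hj, hj'⟩ := lam_lt_iff.1 (not_le.1 hlt)
  obtain ⟨i, hi, hi'⟩ := lam_lt_iff.1 a.2
  replace hi : ∀ k < i, 0 = ofLex a.1 k := hi
  replace hi' : 0 < ofLex a.1 i := hi'
  rcases lt_trichotomy i j with h | rfl | h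
  · rw [hj i h, Pos.one_apply_of_ne (h.trans_le (le_rev_zero j)).ne] at hi'
    exact hi'.false
  · rcases eq_or_ne i (Fin.rev 0) with rfl | hne
    · rw [Pos.one_apply_rev_zero] at hj'
      omega
    · rw [Pos.one_apply_of_ne hne] at hj'
      omega
  · rw [Pos.one_apply_of_ne (h.trans_le (le_rev_zero i)).ne, ← hi j h] at hj'
    exact hj'.false

theorem one_lt_bdPos [NeZero n] (b : BdPos n) :
    toLex (fun i => (ofLex (Pos.one : Pos n).1 i : WithTop ℤ)) < toLex b.1 := by
  obtain ⟨i, hi, hi'⟩ := b.2.1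
  replace hi : ∀ k < i, 0 = b.1 k := hi
  replace hi' : 0 < b.1 i := hi'
  refine coe_lt_iff.2 ⟨i, fun j hj => ?_, ?_⟩
  · rw [Pos.one_apply_of_ne (hj.trans_le (le_rev_zero i)).ne, ← hi j hj]
    rfl
  · rcases eq_or_ne i (Fin.rev 0) with rfl | h
    · rw [b.2.2.1 (Fin.rev 0) (by simp [Fin.val_rev, Nat.sub_add_cancel NeZero.one_le])]
      exact WithTop.coe_lt_top _
    · rw [Pos.one_apply_of_ne h]
      exact hi'

/-- A cut of `Λ` without a maximal element is determined by a tuple with entries in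
`ℤ ∪ {∞}`. -/
theorem exists_cut [NeZero n] (D : Set (Lam n)) (hne : D.Nonempty)
    (hdown : ∀ a ∈ D, ∀ c, c < a → c ∈ D) (hstep : ∀ a ∈ D, ∃ c ∈ D, a < c) :
    ∃ b : Fin n → WithTop ℤ, (∀ i : Fin n, (i : ℕ) + 1 = n → b i = ⊤) ∧
      (∀ i j : Fin n, i ≤ j → b i = ⊤ → b j = ⊤) ∧
      ∀ a : Lam n, a ∈ D ↔ toLex (fun i => (ofLex a i : WithTop ℤ)) < toLex b := by
  -- `M i a`: the first `i` coordinates of `a ∈ D` are lexicographically largest in `D`. Since `D`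
  -- has no maximum, `M` fails at `n`; at the last `i` where it holds, the next coordinate is
  -- unbounded, and the cut is `(a₀, …, aᵢ₋₁, ∞, …, ∞)`.
  let M : ℕ → Lam n → Prop := fun i a => a ∈ D ∧ ∀ c ∈ D,
    (∀ j : Fin n, (j : ℕ) < i → ofLex c j = ofLex a j) ∨
      ∃ j : Fin n, (j : ℕ) < i ∧ (∀ k < j, ofLex c k = ofLex a k) ∧ ofLex c j < ofLex a j
  obtain ⟨i, hin, a, hMa, hMs⟩ : ∃ i, ∃ hi : i < n, ∃ a, M i a ∧ ¬ ∃ a', M (i + 1) a' := by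
    by_contra hcon
    have hM : ∀ i ≤ n, ∃ a, M i a := fun i => by
      induction i with
      | zero => exact fun _ => hne.imp fun a ha => ⟨ha, fun c _ => Or.inl fun j hj => by omega⟩
      | succ i ih =>
        intro hi
        obtain ⟨a, ha⟩ := ih (by omega)
        by_contra h
        exact hcon ⟨i, hi, a, ha, h⟩
    obtain ⟨a, ha, hmax⟩ := hM n le_rfl
    obtain ⟨c, hc, hac⟩ := hstep a ha
    obtain ⟨m, hm, hm'⟩ := lam_lt_iff.1 hac
    rcases hmax c hc with h | ⟨j, -, hj, hj'⟩
    · exact hm'.ne' (h m m.2)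
    · exact (lam_lt_iff.2 ⟨j, hj, hj'⟩ : c < a).not_gt hac
  have hunb : ∀ k : ℤ, ∃ c ∈ D, (∀ j : Fin n, (j : ℕ) < i → ofLex c j = ofLex a j) ∧
      k < ofLex c ⟨i, hin⟩ := by
    by_contra! hb
    obtain ⟨k, hk⟩ := hb
    obtain ⟨m, ⟨c, hc, hca, rfl⟩, hmax⟩ := Int.exists_greatest_of_bdd
      (P := fun m => ∃ c ∈ D, (∀ j : Fin n, (j : ℕ) < i → ofLex c j = ofLex a j) ∧
        ofLex c ⟨i, hin⟩ = m)
      ⟨k, by rintro _ ⟨c, hc, hca, rfl⟩; exact hk c hc hca⟩ ⟨_, a, hMa.1, fun _ _ => rfl, rfl⟩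
    refine hMs ⟨c, hc, fun d hd => ?_⟩
    rcases hMa.2 d hd with h | ⟨j, hji, hj, hj'⟩
    · rcases (hmax _ ⟨d, hd, h, rfl⟩).eq_or_lt with he | hlt
      · refine Or.inl fun j hj => ?_
        rcases Nat.lt_succ_iff_lt_or_eq.1 hj with hj | hj
        · rw [h j hj, hca j hj]
        · obtain rfl : j = ⟨i, hin⟩ := Fin.ext hj
          exact he
      · exact Or.inr ⟨⟨i, hin⟩, Nat.lt_succ_self i,
          fun k hk => by rw [h k hk, hca k hk], hlt⟩
    · refine Or.inr ⟨j, by omega, fun k hk => ?_, by rwa [hca j hji]⟩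
      rw [hj k hk, hca k (lt_trans (Fin.lt_def.1 hk) hji)]
  let b : Fin n → WithTop ℤ := fun j => if (j : ℕ) < i then (ofLex a j : WithTop ℤ) else ⊤
  have hblt : ∀ j : Fin n, (j : ℕ) < i → b j = (ofLex a j : WithTop ℤ) := fun j hj => if_pos hj
  have hbge : ∀ j : Fin n, ¬ (j : ℕ) < i → b j = ⊤ := fun j hj => if_neg hj
  refine ⟨b, fun j hj => hbge j (by omega), fun j k hjk hj => ?_, fun c => ?_⟩
  · refine hbge k fun hk => ?_
    rw [hblt j (lt_of_le_of_lt (Fin.le_def.1 hjk) hk)] at hj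
    exact WithTop.coe_ne_top hj
  rw [coe_lt_iff]
  constructor
  · intro hc
    rcases hMa.2 c hc with h | ⟨j, hji, hj, hj'⟩
    · refine ⟨⟨i, hin⟩, fun j hj => ?_, ?_⟩
      · rw [hblt j (Fin.lt_def.1 hj), h j (Fin.lt_def.1 hj)]
      · rw [hbge _ (lt_irrefl i)]
        exact WithTop.coe_lt_top _
    · refine ⟨j, fun k hk => ?_, ?_⟩
      · rw [hblt k (lt_trans (Fin.lt_def.1 hk) hji), hj k hk]
      · rw [hblt j hji]
        exact_mod_cast hj'
  · rintro ⟨j, hj, hj'⟩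
    have hji : (j : ℕ) ≤ i := by
      by_contra hij
      have h := hj ⟨i, hin⟩ (Fin.lt_def.2 (not_le.1 hij))
      rw [hbge _ (lt_irrefl i)] at h
      exact WithTop.coe_ne_top h
    have hca : ∀ k < j, ofLex c k = ofLex a k := fun k hk => by
      have h := hj k hk
      rw [hblt k ((Fin.lt_def.1 hk).trans_le hji)] at h
      exact_mod_cast h
    rcases hji.lt_or_eq with hji | hji
    · rw [hblt j hji] at hj'
      exact hdown a hMa.1 c (lam_lt_iff.2 ⟨j, hca, by exact_mod_cast hj'⟩)
    · obtain ⟨d, hd, hda, hlt⟩ := hunb (ofLex c j)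
      obtain rfl : j = ⟨i, hin⟩ := Fin.ext hji
      exact hdown d hd c (lam_lt_iff.2 ⟨_, fun k hk => by rw [hca k hk, hda k hk], hlt⟩)

/-- The quotient is the componentwise difference with `∞ - k = ∞`; its first nonzero entry is where
`a` and `b` first differ. -/
theorem exists_addBd_eq_iff (a : Pos n) (b : BdPos n) :
    (∃ c : BdPos n, b = a.addBd c) ↔
      toLex (fun i => (ofLex a.1 i : WithTop ℤ)) < toLex b.1 := by
  rw [coe_lt_iff]
  constructor
  · rintro ⟨c, rfl⟩
    obtain ⟨i, hi, hi'⟩ := c.2.1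
    replace hi : ∀ k < i, 0 = c.1 k := hi
    replace hi' : 0 < c.1 i := hi'
    refine ⟨i, fun j hj => ?_, ?_⟩
    · change _ = (ofLex a.1 j : WithTop ℤ) + c.1 j
      rw [← hi j hj, add_zero]
    · change _ < (ofLex a.1 i : WithTop ℤ) + c.1 i
      generalize c.1 i = m at hi'
      induction m with
      | top => simp
      | coe m =>
        have : 0 < m := by exact_mod_cast hi'
        exact_mod_cast lt_add_of_pos_right _ this
  · rintro ⟨i, hi, hi'⟩
    have hmap : ∀ (m : WithTop ℤ) (k : ℤ), (k : WithTop ℤ) + m.map (fun x => x - k) = m :=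
      fun m k => by
        induction m with
        | top => simp
        | coe m =>
          change ((k + (m - k) : ℤ) : WithTop ℤ) = m
          simp
    refine ⟨⟨fun j => (b.1 j).map (fun x => x - ofLex a.1 j), ⟨i, fun j hj => ?_, ?_⟩,
      fun j hj => ?_, fun j k hjk hj => ?_⟩, Subtype.ext (funext fun j => (hmap _ _).symm)⟩
    · change (0 : WithTop ℤ) = (b.1 j).map (fun x => x - ofLex a.1 j)
      rw [← hi j hj]
      change (0 : WithTop ℤ) = ((ofLex a.1 j - ofLex a.1 j : ℤ) : WithTop ℤ)
      simp
    · change (0 : WithTop ℤ) < (b.1 i).map (fun x => x - ofLex a.1 i)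
      generalize b.1 i = m at hi'
      induction m with
      | top => exact WithTop.coe_lt_top (0 : ℤ)
      | coe m =>
        have : ofLex a.1 i < m := by exact_mod_cast hi'
        change ((0 : ℤ) : WithTop ℤ) < ((m - ofLex a.1 i : ℤ) : WithTop ℤ)
        exact_mod_cast sub_pos.2 this
    · exact WithTop.map_eq_top_iff.2 (b.2.2.1 j hj)
    · exact WithTop.map_eq_top_iff.2 (b.2.2.2 j k hjk (WithTop.map_eq_top_iff.1 hj))

theorem mem_V_of_app {p t : Word n} {x : Bd n} (h : x ∈ V (p.app t)) : x ∈ V p := by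
  obtain ⟨y, rfl⟩ := h
  exact ⟨t.mul y, (Word.app_mul p t y).symm⟩

theorem comparable_of_mem_V {p q : Word n} {x : Bd n} (hp : x ∈ V p) (hq : x ∈ V q) :
    (∃ t : Word n, q = p.app t) ∨ ∃ t : Word n, p = q.app t := by
  obtain ⟨y, hy⟩ := hp
  obtain ⟨z, hz⟩ := hq
  exact (Word.comparable (hy.trans hz.symm)).imp (fun ⟨t, h, _⟩ => ⟨t, h⟩) fun ⟨t, h, _⟩ => ⟨t, h⟩

theorem exists_consMul_eq (a : Letter n) (t : List (Letter n)) :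
    ∃ b w, consMul a t = (a.1, b) :: w := by
  rcases t with _ | ⟨v, t⟩
  · exact ⟨_, _, rfl⟩
  · simp only [consMul]
    split_ifs with h
    · exact ⟨_, _, by rw [h]⟩
    · exact ⟨_, _, rfl⟩

theorem Word.app_val {p t : Word n} {p' : List (Letter n)} {a : Letter n}
    (hp : p.1 = p' ++ [a]) : (p.app t).1 = p' ++ consMul a t.1 := by
  change p.1.foldr consMul t.1 = _
  rw [hp, List.foldr_append]
  refine foldr_consMul_of_alt ?_
  obtain ⟨b, w, hw⟩ := exists_consMul_eq a t.1
  have h1 : Alt (p' ++ [a]) := hp ▸ p.2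
  have h2 : Alt (consMul a t.1) := alt_consMul a t.2
  change Alt (p' ++ consMul a t.1)
  rw [hw] at h2 ⊢
  rw [Alt, List.map_append, List.isChain_append] at h1 ⊢
  exact ⟨h1.1, h2, fun x hx y hy => h1.2.2 x hx y (by simpa using hy)⟩

/-- Only the last letter of `p` can grow when `p` is extended, so along a chain of words all other
letters are final. -/
theorem Word.dropLast_prefix_app (p t : Word n) : p.1.dropLast <+: (p.app t).1.dropLast := by
  rcases List.eq_nil_or_concat' p.1 with h | ⟨p', a, h⟩
  · simp [h]
  · obtain ⟨b, w, hw⟩ := exists_consMul_eq a t.1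
    rw [Word.app_val h, h, hw, List.dropLast_append_of_ne_nil (List.cons_ne_nil _ _)]
    simp

theorem Word.card_le_app (p t : Word n) : p.1.length ≤ (p.app t).1.length := by
  rcases List.eq_nil_or_concat' p.1 with h | ⟨p', a, h⟩
  · simp [h]
  · obtain ⟨b, w, hw⟩ := exists_consMul_eq a t.1
    rw [Word.app_val h, h, hw]
    simp

/-- The word with one letter. -/
def Word.single (u : Letter n) : Word n := ⟨[u], List.isChain_singleton _⟩

theorem letterMul_inf (w : ℕ → Letter n) (h : ∀ m, (w m).1 ≠ (w (m + 1)).1) :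
    letterMul (w 0) (.inf (fun m => w (m + 1)) fun m => h (m + 1)) = .inf w h := by
  refine (dif_neg (h 0)).trans ?_
  rw [Bd.inf.injEq]
  funext m
  cases m <;> rfl

theorem foldr_letterMul_inf (w : ℕ → Letter n) (h : ∀ m, (w m).1 ≠ (w (m + 1)).1) (j : ℕ) :
    ((List.range j).map w).foldr letterMul
      (.inf (fun m => w (m + j)) fun m => by rw [add_right_comm]; exact h (m + j)) = .inf w h := by
  induction j with
  | zero => rfl
  | succ j ih =>
    rw [List.range_succ, List.map_append, List.foldr_append, ← ih]
    congr 1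
    have := letterMul_inf (fun m => w (m + j)) fun m => by rw [add_right_comm]; exact h (m + j)
    simp only [zero_add, add_right_comm _ 1 j] at this
    exact this

theorem letterMul_fin {u : Letter n} {w : List (Letter n)} {i : Bool} {b : BdPos n}
    {h : (w.map Prod.fst ++ [i]).IsChain (· ≠ ·)}
    (h' : ((u :: w).map Prod.fst ++ [i]).IsChain (· ≠ ·)) :
    letterMul u (.fin w i b h) = .fin (u :: w) i b h' := by
  rcases w with _ | ⟨v, w⟩ <;> exact dif_neg (List.isChain_cons_cons.1 h').1

theorem foldr_letterMul_fin {p : List (Letter n)} {i : Bool} {b : BdPos n}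
    (h : (p.map Prod.fst ++ [i]).IsChain (· ≠ ·)) :
    p.foldr letterMul (.fin [] i b (List.isChain_singleton _)) = .fin p i b h := by
  induction p with
  | nil => rfl
  | cons u p ih => exact (congrArg (letterMul u) (ih h.tail)).trans (letterMul_fin h)

/-- The first letter of `t` must merge into the only entry. A second letter would lie in the other
copy and block the merging. -/
theorem Word.eq_of_mul_eq_fin {t : Word n} {y : Bd n} {i : Bool} {b : BdPos n}
    {h : ([] ++ [i] : List Bool).IsChain (· ≠ ·)} (hy : t.mul y = .fin [] i b h) :
    t = Word.nil ∨ ∃ c b', t = Word.single (i, c) ∧ b = c.addBd b' := by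
  obtain ⟨_ | ⟨u, t⟩, ht⟩ := t
  · exact Or.inl rfl
  refine Or.inr ?_
  change letterMul u (t.foldr letterMul y) = _ at hy
  obtain ⟨b', h', hz, hu, hb⟩ : ∃ b' h', t.foldr letterMul y = .fin [] i b' h' ∧ u.1 = i ∧
      b = u.2.addBd b' := by
    generalize t.foldr letterMul y = z at hy
    rcases z with ⟨_ | ⟨v, w⟩, j, c, hc⟩ | ⟨w, hw⟩ <;> simp only [letterMul] at hy <;>
      split_ifs at hy with h1 <;>
      simp only [Bd.fin.injEq, reduceCtorEq, false_and, true_and] at hy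
    obtain ⟨rfl, rfl⟩ := hy
    exact ⟨c, hc, rfl, h1, rfl⟩
  obtain ⟨s, a⟩ := u
  obtain rfl : s = i := hu
  rcases t with _ | ⟨v, t⟩
  · exact ⟨a, b', rfl, hb⟩
  · have h2 := congrArg Bd.head hz
    rw [head_foldr_letterMul] at h2
    exact absurd h2.symm (List.isChain_cons_cons.1 ht).1

/-- Both `S` and the set of prefixes of `x` are closed under prefixes, so they agree once `C` is
cofinal in each. -/
theorem mem_V_iff_of_cofinal {S C : Set (Word n)} {x : Bd n}
    (hdown : ∀ p t : Word n, p.app t ∈ S → p ∈ S) (hCS : C ⊆ S) (hCx : ∀ c ∈ C, x ∈ V c)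
    (h1 : ∀ p, p ∈ S ∨ x ∈ V p → ∃ c ∈ C, ∃ t, c = p.app t) (p : Word n) :
    x ∈ V p ↔ p ∈ S := by
  constructor <;> intro h
  · obtain ⟨c, hc, t, rfl⟩ := h1 p (Or.inr h)
    exact hdown p t (hCS hc)
  · obtain ⟨c, hc, t, rfl⟩ := h1 p (Or.inl h)
    exact mem_V_of_app (hCx _ hc)

theorem exists_inf_of_chain {S : Set (Word n)}
    (hdown : ∀ p t : Word n, p.app t ∈ S → p ∈ S)
    (hchain : ∀ p ∈ S, ∀ q ∈ S, (∃ t : Word n, q = p.app t) ∨ ∃ t : Word n, p = q.app t)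
    (hunb : ∀ d, ∃ p ∈ S, d ≤ p.1.length) : ∃ x, ∀ p, x ∈ V p ↔ p ∈ S := by
  choose P hPS hP using hunb
  have hagree : ∀ p ∈ S, ∀ q ∈ S, ∀ j (hp : j + 1 < p.1.length) (hq : j + 1 < q.1.length),
      p.1[j] = q.1[j] := fun p hp q hq j hjp hjq => by
    have key : ∀ (p t : Word n) (hp : j + 1 < p.1.length) (hq : j + 1 < (p.app t).1.length),
        p.1[j] = (p.app t).1[j] := fun p t hp hq => by
      have h := (Word.dropLast_prefix_app p t).getElem (i := j) (by simp; omega)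
      simpa using h
    rcases hchain p hp q hq with ⟨t, rfl⟩ | ⟨t, rfl⟩
    · exact key p t hjp hjq
    · exact (key q t hjq hjp).symm
  -- The index `j + 2` ensures that letter `j` is not the last one of its word, hence is final.
  let w : ℕ → Letter n := fun j => (P (j + 2)).1[j]'(by have := hP (j + 2); omega)
  have hw : ∀ p ∈ S, ∀ j (hp : j + 1 < p.1.length), p.1[j] = w j := fun p hp j hj =>
    hagree p hp _ (hPS _) j hj (by have := hP (j + 2); omega)
  have halt : ∀ m, (w m).1 ≠ (w (m + 1)).1 := fun m => by
    have hl := hP (m + 3)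
    rw [← hw _ (hPS (m + 3)) m (by omega), ← hw _ (hPS (m + 3)) (m + 1) (by omega)]
    have := List.isChain_iff_getElem.1 (P (m + 3)).2 m (by simp; omega)
    simpa using this
  have htake : ∀ j, (P (j + 1)).1.take j = (List.range j).map w := fun j => by
    have hl := hP (j + 1)
    refine List.ext_getElem (by simp; omega) fun k hk hk' => ?_
    simp only [List.length_map, List.length_range] at hk'
    simp only [List.getElem_take, List.getElem_map, List.getElem_range]
    exact hw _ (hPS _) k (by omega)
  let c : ℕ → Word n := fun j =>
    ⟨(P (j + 1)).1.take j, by rw [List.map_take]; exact (P (j + 1)).2.take j⟩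
  have hclen : ∀ j, (c j).1.length = j := fun j => by
    change ((P (j + 1)).1.take j).length = j
    have hl := hP (j + 1)
    simp
    omega
  have hcS : ∀ j, c j ∈ S := fun j => by
    refine hdown (c j) ⟨(P (j + 1)).1.drop j, by rw [List.map_drop]; exact (P (j + 1)).2.drop j⟩ ?_
    convert hPS (j + 1)
    refine Subtype.ext ((foldr_consMul_of_alt ?_).trans (List.take_append_drop _ _))
    rw [List.take_append_drop]
    exact (P (j + 1)).2
  have hcx : ∀ j, Bd.inf w halt ∈ V (c j) := fun j => by
    refine ⟨.inf (fun m => w (m + j)) fun m => by rw [add_right_comm]; exact halt (m + j),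
      Eq.trans ?_ (foldr_letterMul_inf w halt j)⟩
    exact congrArg (List.foldr letterMul _) (htake j)
  refine ⟨.inf w halt, mem_V_iff_of_cofinal hdown (C := Set.range c) ?_ ?_ fun p hp => ?_⟩
  · rintro _ ⟨j, rfl⟩
    exact hcS j
  · rintro _ ⟨j, rfl⟩
    exact hcx j
  · refine ⟨c (p.1.length + 1), ⟨_, rfl⟩, ?_⟩
    have hcomp : (∃ t : Word n, c (p.1.length + 1) = p.app t) ∨
        ∃ t : Word n, p = (c (p.1.length + 1)).app t := by
      rcases hp with hp | hp
      · exact hchain p hp _ (hcS _)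
      · exact comparable_of_mem_V hp (hcx _)
    refine hcomp.resolve_right ?_
    rintro ⟨t, ht⟩
    have h1 := Word.card_le_app (c (p.1.length + 1)) t
    rw [← ht, hclen] at h1
    omega

theorem exists_fin_of_chain [NeZero n] {S : Set (Word n)}
    (hdown : ∀ p t : Word n, p.app t ∈ S → p ∈ S)
    (hchain : ∀ p ∈ S, ∀ q ∈ S, (∃ t : Word n, q = p.app t) ∨ ∃ t : Word n, p = q.app t)
    (hstep : ∀ p ∈ S, ∃ i, p.app (Word.single (i, Pos.one)) ∈ S)
    {p₀ : Word n} (hp₀ : p₀ ∈ S) (hmax : ∀ p ∈ S, p.1.length ≤ p₀.1.length)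
    {p' : List (Letter n)} {i : Bool} {a₀ : Pos n} (hpa : p₀.1 = p' ++ [(i, a₀)]) :
    ∃ x, ∀ p, x ∈ V p ↔ p ∈ S := by
  have hch : (p'.map Prod.fst ++ [i]).IsChain (· ≠ ·) := by
    have := p₀.2
    rw [hpa] at this
    simpa using this
  let c : Pos n → Word n := fun a => ⟨p' ++ [(i, a)], by simpa using hch⟩
  have hc₀ : c a₀ = p₀ := Subtype.ext hpa.symm
  have hcadd : ∀ a b, (c a).app (Word.single (i, b)) = c (a.add b) := fun a b =>
    Subtype.ext ((Word.app_val (p := c a) rfl).trans (by simp [c, consMul, Word.single]))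
  have hcdown : ∀ a b : Pos n, a.1 ≤ b.1 → c b ∈ S → c a ∈ S := fun a b hab hb => by
    rcases hab.eq_or_lt with h | h
    · rwa [show a = b from Subtype.ext h]
    · refine hdown _ (Word.single (i, b.sub a h)) ?_
      rwa [hcadd, Pos.add_sub_cancel]
  -- An extension in the other copy would have more letters than `p₀`, so the last letter itself
  -- grows.
  have hcstep : ∀ a, c a ∈ S → c (a.add Pos.one) ∈ S := fun a ha => by
    obtain ⟨j, hj⟩ := hstep _ ha
    by_cases hij : i = j
    · subst hij
      rwa [hcadd] at hj
    · have h1 := hmax _ hj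
      rw [Word.app_val (p := c a) rfl, hpa] at h1
      simp [consMul, Word.single, hij] at h1
  -- Nonpositive elements belong to `D` vacuously. This makes `D` a down-set of all of `Λ`, and `0 ∈
  -- D` later gives positivity of the cut.
  let D : Set (Lam n) := {a | ∀ h : 0 < a, c ⟨a, h⟩ ∈ S}
  have hD : ∀ a : Pos n, a.1 ∈ D ↔ c a ∈ S := fun a => ⟨fun h => h a.2, fun h _ => h⟩
  have h0 : (0 : Lam n) ∈ D := fun h => absurd h (lt_irrefl _)
  obtain ⟨b, hb1, hb2, hb⟩ := exists_cut D ⟨0, h0⟩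
    (fun a ha d hd h => hcdown _ ⟨a, h.trans hd⟩ hd.le (ha _)) fun a ha => by
      by_cases h : 0 < a
      · exact ⟨_, (hD _).2 (hcstep ⟨a, h⟩ (ha h)), lt_add_of_pos_right a Pos.one.2⟩
      · exact ⟨a₀.1, (hD _).2 (hc₀ ▸ hp₀), (not_lt.1 h).trans_lt a₀.2⟩
  let B : BdPos n := ⟨b, (hb 0).1 h0, hb1, hb2⟩
  have hB : ∀ a : Pos n, c a ∈ S ↔ ∃ d, B = a.addBd d := fun a =>
    (hD a).symm.trans ((hb a.1).trans (exists_addBd_eq_iff a B).symm)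
  have hmul : ∀ d : BdPos n, ∀ a, (c a).mul (.fin [] i d (List.isChain_singleton _)) =
      .fin p' i (a.addBd d) hch := fun d a => by
    change (p' ++ [(i, a)]).foldr letterMul _ = _
    rw [List.foldr_append, ← foldr_letterMul_fin hch]
    exact congrArg (fun z => List.foldr letterMul z p') (dif_pos rfl)
  have hcx : ∀ a, c a ∈ S → Bd.fin p' i B hch ∈ V (c a) := fun a ha => by
    obtain ⟨d, hd⟩ := (hB a).1 ha
    exact ⟨_, (hmul d a).trans (by rw [← hd])⟩
  refine ⟨.fin p' i B hch, mem_V_iff_of_cofinal hdown (C := {q | ∃ a, c a = q ∧ q ∈ S})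
    (fun q hq => hq.choose_spec.2) ?_ fun p hp => ?_⟩
  · rintro _ ⟨a, rfl, ha⟩
    exact hcx a ha
  have hS₀ : c a₀ ∈ S := hc₀ ▸ hp₀
  have hcomp : (∃ t : Word n, c a₀ = p.app t) ∨ ∃ t : Word n, p = (c a₀).app t := by
    rcases hp with hp | hp
    · exact hchain p hp _ hS₀
    · exact comparable_of_mem_V hp (hcx _ hS₀)
  rcases hcomp with ⟨t, ht⟩ | ⟨t, ht⟩
  · exact ⟨_, ⟨a₀, rfl, hS₀⟩, t, ht⟩
  suffices h : ∃ a, p = c a ∧ c a ∈ S by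
    obtain ⟨a, rfl, ha⟩ := h
    exact ⟨_, ⟨a, rfl, ha⟩, Word.nil, (Word.app_nil _).symm⟩
  rcases hp with hp | ⟨y, hy⟩
  · have hl := hmax p hp
    have hpv : p.1 = p' ++ consMul (i, a₀) t.1 := ht ▸ Word.app_val (p := c a₀) rfl
    obtain ⟨e, u, hu⟩ := exists_consMul_eq (i, a₀) t.1
    rw [hu] at hpv
    rw [hpv, hpa] at hl
    obtain rfl : u = [] := by
      rw [← List.length_eq_zero_iff]
      simpa using hl
    have hpc : p = c e := Subtype.ext hpv
    exact ⟨e, hpc, hpc ▸ hp⟩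
  · obtain ⟨d, hd⟩ := (hB a₀).1 hS₀
    have h1 : t.mul y = .fin [] i d (List.isChain_singleton _) := by
      refine (c a₀).mul_injective ?_
      rw [hmul, ← Word.app_mul, ← ht, hy, hd]
    rcases Word.eq_of_mul_eq_fin h1 with rfl | ⟨e, d', rfl, rfl⟩
    · rw [Word.app_nil] at ht
      exact ⟨a₀, ht, hS₀⟩
    · rw [hcadd] at ht
      refine ⟨_, ht, (hB _).2 ⟨d', ?_⟩⟩
      rw [hd, Pos.add_addBd]

/-- Every maximal chain of words is the set of prefixes of a boundary point. -/
theorem exists_point_of_chain [NeZero n] {S : Set (Word n)} (hnil : Word.nil ∈ S)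
    (hdown : ∀ p t : Word n, p.app t ∈ S → p ∈ S)
    (hchain : ∀ p ∈ S, ∀ q ∈ S, (∃ t : Word n, q = p.app t) ∨ ∃ t : Word n, p = q.app t)
    (hstep : ∀ p ∈ S, ∃ i, p.app (Word.single (i, Pos.one)) ∈ S) :
    ∃ x, ∀ p, x ∈ V p ↔ p ∈ S := by
  by_cases hunb : ∀ d, ∃ p ∈ S, d ≤ p.1.length
  · exact exists_inf_of_chain hdown hchain hunb
  push Not at hunb
  obtain ⟨d, hd⟩ := hunb
  have hbdd : BddAbove ((fun p : Word n => p.1.length) '' S) :=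
    ⟨d, by rintro _ ⟨p, hp, rfl⟩; exact (hd p hp).le⟩
  obtain ⟨p₀, hp₀, hm⟩ := Nat.sSup_mem (Set.Nonempty.image _ ⟨_, hnil⟩) hbdd
  have hmax : ∀ p ∈ S, p.1.length ≤ p₀.1.length := fun p hp =>
    (le_csSup hbdd ⟨p, hp, rfl⟩).trans hm.ge
  rcases List.eq_nil_or_concat' p₀.1 with h | ⟨p', ⟨i, a₀⟩, h⟩
  · obtain ⟨i, hi⟩ := hstep _ hnil
    have h1 : (Word.single (i, (Pos.one : Pos n))).1.length ≤ p₀.1.length := hmax _ hi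
    rw [h] at h1
    simp [Word.single] at h1
  · exact exists_fin_of_chain hdown hchain hstep hp₀ hmax h

/-- Every boundary point starts with a least positive element of one of the two copies. -/
theorem exists_mem_V_single [NeZero n] (x : Bd n) : ∃ i, x ∈ V (Word.single (i, Pos.one)) := by
  have key : ∀ (i : Bool) (a : Pos n) (y : Bd n),
      letterMul (i, a) y ∈ V (Word.single (i, Pos.one)) := fun i a y => by
    rcases a.one_le.eq_or_lt with h | h
    · rw [← show Pos.one = a from Subtype.ext h]
      exact ⟨y, rfl⟩
    · refine ⟨letterMul (i, a.sub _ h) y, ?_⟩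
      change letterMul _ (letterMul _ y) = _
      rw [← letterMul_add, Pos.add_sub_cancel]
  rcases x with ⟨_ | ⟨u, w⟩, i, b, h⟩ | ⟨w, h⟩
  · refine ⟨i, ?_⟩
    obtain ⟨c, hc⟩ := (exists_addBd_eq_iff Pos.one b).2 (one_lt_bdPos b)
    exact ⟨.fin [] i c h, (dif_pos rfl).trans (by rw [← hc])⟩
  · rw [← letterMul_fin (h := h.tail) h]
    exact ⟨_, key _ _ _⟩
  · rw [← letterMul_inf]
    exact ⟨_, key _ _ _⟩

/-! ### Compactness of the boundary and of the basic bisections -/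

theorem V_nil : V (Word.nil : Word n) = Set.univ :=
  Set.eq_univ_of_forall fun x => ⟨x, rfl⟩

theorem isClopen_V (p : Word n) : IsClopen (V p) := by
  refine ⟨⟨TopologicalSpace.isOpen_generateFrom_of_mem (Or.inr ⟨Word.nil, p, ?_⟩)⟩,
    TopologicalSpace.isOpen_generateFrom_of_mem (Or.inl ⟨p, rfl⟩)⟩
  rw [V_nil, Set.compl_eq_univ_sdiff]

/-- For an ultrafilter `U`, the words `p` with `V(p) ∈ U` form a chain: cylinders in `U` meet, and
`V(p)` is the union of the two cylinders obtained by appending the least letter of either copy, so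
`U` picks one. `U` converges to the point defined by this chain. -/
instance [NeZero n] : CompactSpace (Bd n) := by
  refine ⟨isCompact_iff_ultrafilter_le_nhds.2 fun U _ => ?_⟩
  obtain ⟨x, hx⟩ := exists_point_of_chain (S := {p : Word n | V p ∈ U})
    (by rw [Set.mem_ofPred_eq, V_nil]; exact Filter.univ_mem)
    (fun p t h => Filter.mem_of_superset h fun x => mem_V_of_app)
    (fun p hp q hq => by
      obtain ⟨x, hxp, hxq⟩ := U.nonempty_of_mem (Filter.inter_mem hp hq)
      exact comparable_of_mem_V hxp hxq)
    (fun p hp => by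
      have h : V (p.app (Word.single (false, Pos.one))) ∪ V (p.app (Word.single (true, Pos.one)))
          ∈ U := by
        refine Filter.mem_of_superset hp ?_
        rintro _ ⟨y, rfl⟩
        obtain ⟨i, z, rfl⟩ := exists_mem_V_single y
        rw [← Word.app_mul]
        cases i
        · exact Or.inl ⟨z, rfl⟩
        · exact Or.inr ⟨z, rfl⟩
      rcases Ultrafilter.union_mem_iff.1 h with h | h <;> exact ⟨_, h⟩)
  refine ⟨x, trivial, ?_⟩
  rw [TopologicalSpace.nhds_generateFrom]
  refine le_iInf₂ fun A hA => Filter.le_principal_iff.2 ?_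
  obtain ⟨hxA, ⟨p, rfl⟩ | ⟨p, q, rfl⟩⟩ := hA
  · exact (hx p).1 hxA
  · exact Filter.inter_mem ((hx p).1 hxA.1)
      (Ultrafilter.compl_mem_iff_notMem.2 fun h => hxA.2 ((hx q).2 h))

/-- The bisection `[p, q]` in `𝒢₀`; it is empty unless `l(p) = l(q)`. -/
def bis (p q : Word n) : Set (Gpd₀ n) := Subtype.val ⁻¹' bisection p q Set.univ

theorem gpd₀_ext {γ δ : Gpd₀ n} (hr : γ.1.rng = δ.1.rng) (hs : γ.1.src = δ.1.src) : γ = δ :=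
  Subtype.ext (Gpd.ext hr (γ.2.trans δ.2.symm) hs)

theorem mem_bis {p q : Word n} {γ : Gpd₀ n} :
    γ ∈ bis p q ↔ p.length = q.length ∧ ∃ x, γ.1.rng = p.mul x ∧ γ.1.src = q.mul x := by
  constructor
  · rintro ⟨x, -, h1, h2, h3⟩
    rw [γ.2] at h2
    exact ⟨sub_eq_zero.1 h2.symm, x, h1, h3⟩
  · rintro ⟨hl, x, h1, h3⟩
    exact ⟨x, trivial, h1, γ.2.trans (sub_eq_zero.2 hl).symm, h3⟩

theorem exists_mem_bis (γ : Gpd₀ n) : ∃ p q, γ ∈ bis p q := by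
  obtain ⟨p, q, z, h⟩ := γ.1.rel
  exact ⟨p, q, z, trivial, h.2.1, h.1, h.2.2⟩

theorem injOn_rng_bis (p q : Word n) : Set.InjOn (fun γ : Gpd₀ n => γ.1.rng) (bis p q) := by
  intro γ hγ δ hδ h
  obtain ⟨-, x, h1, h2⟩ := mem_bis.1 hγ
  obtain ⟨-, y, h3, h4⟩ := mem_bis.1 hδ
  obtain rfl : x = y := p.mul_injective (h1.symm.trans (Eq.trans h h3))
  exact gpd₀_ext h (h2.trans h4.symm)

theorem inv₀_mem_bis {p q : Word n} {γ : Gpd₀ n} : inv₀ γ ∈ bis p q ↔ γ ∈ bis q p := by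
  simp only [mem_bis]
  exact and_congr eq_comm (exists_congr fun x => and_comm)

theorem injOn_src_bis (p q : Word n) : Set.InjOn (fun γ : Gpd₀ n => γ.1.src) (bis p q) := by
  intro γ hγ δ hδ h
  have := injOn_rng_bis q p (inv₀_mem_bis.2 hγ) (inv₀_mem_bis.2 hδ) h
  exact gpd₀_ext (congrArg (fun g : Gpd₀ n => g.1.src) this) h

/-- Together with `preimage_bisection_diff`, this expresses the topology of `𝒢₀` through the sets
`bis` alone. -/
theorem preimage_bisection_V (p q t : Word n) :
    (Subtype.val ⁻¹' bisection p q (V t) : Set (Gpd₀ n)) = bis (p.app t) (q.app t) := by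
  ext γ
  rw [mem_bis, Word.length_app, Word.length_app, add_left_inj]
  constructor
  · rintro ⟨_, ⟨x, rfl⟩, h1, h2, h3⟩
    rw [γ.2] at h2
    rw [← Word.app_mul] at h1 h3
    exact ⟨sub_eq_zero.1 h2.symm, x, h1, h3⟩
  · rintro ⟨hl, x, h1, h3⟩
    rw [Word.app_mul] at h1 h3
    exact ⟨t.mul x, ⟨x, rfl⟩, h1, γ.2.trans (sub_eq_zero.2 hl).symm, h3⟩

theorem preimage_bisection_diff (p q : Word n) (A B : Set (Bd n)) :
    (Subtype.val ⁻¹' bisection p q (A \ B) : Set (Gpd₀ n)) =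
      Subtype.val ⁻¹' bisection p q A \ Subtype.val ⁻¹' bisection p q B := by
  ext γ
  constructor
  · rintro ⟨x, hx, h1, h2, h3⟩
    refine ⟨⟨x, hx.1, h1, h2, h3⟩, fun ⟨y, hy, h4, _⟩ => hx.2 ?_⟩
    rwa [p.mul_injective (h1.symm.trans h4)]
  · rintro ⟨⟨x, hx, h1, h2, h3⟩, h⟩
    exact ⟨x, ⟨hx, fun hB => h ⟨x, hB, h1, h2, h3⟩⟩, h1, h2, h3⟩

theorem isOpen_bis (p q : Word n) : IsOpen (bis p q) := isOpen_bisection_univ p q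

theorem isOpen_bis_diff (p q t : Word n) : IsOpen (bis p q \ bis (p.app t) (q.app t)) := by
  rw [← preimage_bisection_V p q t, bis, ← V_nil, ← preimage_bisection_diff]
  exact IsOpen.preimage continuous_subtype_val (TopologicalSpace.isOpen_generateFrom_of_mem
    ⟨p, q, _, Or.inr ⟨_, _, rfl⟩, rfl⟩)

theorem bis_app_subset (p q t : Word n) : bis (p.app t) (q.app t) ⊆ bis p q := fun γ hγ => by
  rw [mem_bis, Word.length_app, Word.length_app, add_left_inj] at hγ
  obtain ⟨hl, x, h1, h2⟩ := hγ
  rw [Word.app_mul] at h1 h2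
  exact mem_bis.2 ⟨hl, _, h1, h2⟩

/-- Two basic bisections are nested or disjoint. -/
theorem bis_trichotomy (p q r s : Word n) :
    (∃ t : Word n, r = p.app t ∧ s = q.app t) ∨ (∃ t : Word n, p = r.app t ∧ q = s.app t) ∨
      Disjoint (bis p q) (bis r s) := by
  by_contra! h
  obtain ⟨h1, h2, h3⟩ := h
  obtain ⟨γ, hγ, hγ'⟩ := Set.not_disjoint_iff.1 h3
  obtain ⟨hl, x, hr, hs⟩ := mem_bis.1 hγ
  obtain ⟨hl', y, hr', hs'⟩ := mem_bis.1 hγ'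
  rcases Word.comparable (hr.symm.trans hr') with ⟨t, rfl, rfl⟩ | ⟨t, rfl, rfl⟩
  · refine h1 t rfl (Word.eq_of_mul_eq (x := y) (y := y) ?_ ?_)
    · rw [Word.app_mul, ← hs', hs]
    · rw [← hl', Word.length_app, Word.length_app, hl]
  · refine h2 t rfl (Word.eq_of_mul_eq (x := x) (y := x) ?_ ?_)
    · rw [Word.app_mul, ← hs, hs']
    · rw [← hl, Word.length_app, Word.length_app, hl']

/-- A point outside lies in some `[r, s]` that is disjoint from `[p, q]` or contains it; in the
second case the difference is a basic open set. -/
theorem isClosed_bis (p q : Word n) : IsClosed (bis p q) := by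
  refine ⟨isOpen_iff_forall_mem_open.2 fun γ hγ => ?_⟩
  obtain ⟨r, s, hrs⟩ := exists_mem_bis γ
  rcases bis_trichotomy p q r s with ⟨t, rfl, rfl⟩ | ⟨t, rfl, rfl⟩ | h
  · exact absurd (bis_app_subset p q t hrs) hγ
  · exact ⟨_, fun δ hδ => hδ.2, isOpen_bis_diff r s t, hrs, hγ⟩
  · exact ⟨_, h.symm.subset_compl_right, isOpen_bis r s, hrs⟩

/-- The point `(px, 0, qx)` of `𝒢₀`. -/
def bisPoint (p q : Word n) (h : p.length = q.length) (x : Bd n) : Gpd₀ n :=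
  ⟨⟨p.mul x, 0, q.mul x, p, q, x, (sub_eq_zero.2 h).symm, rfl, rfl⟩, rfl⟩

theorem bisPoint_mem (p q : Word n) (h : p.length = q.length) (x : Bd n) :
    bisPoint p q h x ∈ bis p q := mem_bis.2 ⟨h, x, rfl, rfl⟩

theorem isClopen_bisPoint_preimage (p q : Word n) (h : p.length = q.length) (r s : Word n) :
    IsClopen (bisPoint p q h ⁻¹' bis r s) := by
  rcases bis_trichotomy p q r s with ⟨t, rfl, rfl⟩ | ⟨t, rfl, rfl⟩ | hd
  · convert isClopen_V t
    ext x
    rw [Set.mem_preimage, mem_bis, Word.length_app, Word.length_app, add_left_inj]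
    constructor
    · rintro ⟨-, y, h1, -⟩
      rw [Word.app_mul] at h1
      exact ⟨y, (p.mul_injective h1).symm⟩
    · rintro ⟨y, rfl⟩
      exact ⟨h, y, (Word.app_mul _ _ _).symm, (Word.app_mul _ _ _).symm⟩
  · convert isClopen_univ
    exact Set.eq_univ_of_forall fun x => bis_app_subset r s t (bisPoint_mem _ _ h x)
  · convert isClopen_empty
    exact Set.eq_empty_of_forall_notMem fun x hx =>
      Set.disjoint_left.1 hd (bisPoint_mem _ _ h x) hx

theorem continuous_bisPoint (p q : Word n) (h : p.length = q.length) :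
    Continuous (bisPoint p q h) := by
  refine continuous_induced_rng.2 (continuous_generateFrom_iff.2 ?_)
  rintro _ ⟨r, s, A, ⟨t, rfl⟩ | ⟨t, u, rfl⟩, rfl⟩ <;> rw [Set.preimage_comp]
  · rw [preimage_bisection_V]
    exact (isClopen_bisPoint_preimage _ _ _ _ _).isOpen
  · rw [preimage_bisection_diff, preimage_bisection_V, preimage_bisection_V, Set.preimage_sdiff]
    exact ((isClopen_bisPoint_preimage _ _ _ _ _).diff
      (isClopen_bisPoint_preimage _ _ _ _ _)).isOpen

theorem isCompact_bis [NeZero n] (p q : Word n) : IsCompact (bis p q) := by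
  by_cases h : p.length = q.length
  · convert isCompact_range (continuous_bisPoint p q h)
    refine (Set.range_subset_iff.2 (bisPoint_mem p q h)).antisymm' fun γ hγ => ?_
    obtain ⟨-, x, h1, h2⟩ := mem_bis.1 hγ
    exact ⟨x, gpd₀_ext h1.symm h2.symm⟩
  · convert isCompact_empty
    exact Set.eq_empty_of_forall_notMem fun γ hγ => h (mem_bis.1 hγ).1

/-! ### The convolution of indicator functions -/

/-- Injectivity of the range map on `S` leaves at most one factorisation `γ = αβ` with `α ∈ S`, so
the convolution sum has at most one nonzero term. -/
theorem conv_indicator {S T U : Set (Gpd₀ n)} (hS : Set.InjOn (fun γ : Gpd₀ n => γ.1.rng) S)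
    (hU : ∀ γ : Gpd₀ n, γ ∈ U ↔ ∃ α ∈ S, ∃ β ∈ T, IsMul α.1 β.1 γ.1) :
    conv (S.indicator 1) (T.indicator 1) = U.indicator 1 := by
  classical
  funext γ
  have hne : ∀ ab : {ab : Gpd₀ n × Gpd₀ n // IsMul ab.1.1 ab.2.1 γ.1},
      S.indicator (1 : Gpd₀ n → ℂ) ab.1.1 * T.indicator (1 : Gpd₀ n → ℂ) ab.1.2 ≠ 0 →
        ab.1.1 ∈ S ∧ ab.1.2 ∈ T := fun ab h =>
    ⟨Set.mem_of_indicator_ne_zero (left_ne_zero_of_mul h),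
      Set.mem_of_indicator_ne_zero (right_ne_zero_of_mul h)⟩
  by_cases hγ : γ ∈ U
  · obtain ⟨α, hα, β, hβ, hm⟩ := (hU γ).1 hγ
    rw [conv, finsum_eq_single _ ⟨(α, β), hm⟩]
    · simp [hα, hβ, hγ]
    · rintro ⟨⟨α', β'⟩, hm'⟩ hab
      by_contra h
      obtain ⟨hα', hβ'⟩ := hne _ h
      obtain rfl : α' = α := hS hα' hα (hm'.2.1.symm.trans hm.2.1)
      obtain rfl : β' = β := gpd₀_ext (hm'.1.symm.trans hm.1) (hm'.2.2.2.symm.trans hm.2.2.2)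
      exact hab rfl
  · rw [Set.indicator_of_notMem hγ, conv]
    refine (finsum_congr fun ab => ?_).trans finsum_zero
    by_contra h
    exact hγ ((hU γ).2 ⟨_, (hne ab h).1, _, (hne ab h).2, ab.2⟩)

theorem mem_bis_mul_iff {p q r s : Word n} {γ : Gpd₀ n} :
    (∃ α ∈ bis p q, ∃ β ∈ bis r s, IsMul α.1 β.1 γ.1) ↔ p.length = q.length ∧
      r.length = s.length ∧ ∃ x y, q.mul x = r.mul y ∧ γ.1.rng = p.mul x ∧ γ.1.src = s.mul y := by
  constructor
  · rintro ⟨α, hα, β, hβ, h1, h2, -, h3⟩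
    obtain ⟨hl, x, hx, hx'⟩ := mem_bis.1 hα
    obtain ⟨hl', y, hy, hy'⟩ := mem_bis.1 hβ
    exact ⟨hl, hl', x, y, by rw [← hx', h1, hy], h2.trans hx, h3.trans hy'⟩
  · rintro ⟨hl, hl', x, y, h1, h2, h3⟩
    exact ⟨_, bisPoint_mem p q hl x, _, bisPoint_mem r s hl' y, h1, h2, by
      rw [γ.2]
      exact (add_zero _).symm, h3⟩

theorem exists_conv_bis {F : Set (Word n)} (hF : ExchangeClosed F) {p q r s : Word n}
    (hp : p ∈ F) (hq : q ∈ F) (hr : r ∈ F) (hs : s ∈ F) :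
    conv ((bis p q).indicator 1) ((bis r s).indicator 1) = 0 ∨ ∃ p' ∈ F, ∃ s' ∈ F,
      conv ((bis p q).indicator 1) ((bis r s).indicator 1) = (bis p' s').indicator 1 := by
  have hcongr := fun U => conv_indicator (T := bis r s) (U := U) (injOn_rng_bis p q)
  simp only [mem_bis_mul_iff] at hcongr
  by_cases h : p.length = q.length ∧ r.length = s.length ∧ ∃ x y, q.mul x = r.mul y
  · obtain ⟨hl, hl', x, y, hxy⟩ := h
    refine Or.inr ?_
    rcases Word.comparable hxy with ⟨t, rfl, -⟩ | ⟨t, rfl, -⟩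
    · refine ⟨p.app t, hF p hp q hq t hr hl, s, hs, hcongr _ fun γ => ?_⟩
      rw [mem_bis, ← hl', Word.length_app, Word.length_app]
      constructor
      · rintro ⟨-, z, h1, h2⟩
        exact ⟨hl, rfl, t.mul z, z, (Word.app_mul _ _ _).symm, h1.trans (Word.app_mul _ _ _), h2⟩
      · rintro ⟨-, -, z, z', h1, h2, h3⟩
        refine ⟨by rw [hl], z', ?_, h3⟩
        rw [Word.app_mul] at h1
        rw [h2, q.mul_injective h1, Word.app_mul]
    · refine ⟨p, hp, s.app t, hF s hs r hr t hq hl'.symm, hcongr _ fun γ => ?_⟩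
      rw [mem_bis, hl, Word.length_app, Word.length_app]
      constructor
      · rintro ⟨-, z, h1, h2⟩
        exact ⟨rfl, hl', z, t.mul z, Word.app_mul _ _ _, h1, h2.trans (Word.app_mul _ _ _)⟩
      · rintro ⟨-, -, z, z', h1, h2, h3⟩
        refine ⟨by rw [hl'], z, h2, ?_⟩
        rw [Word.app_mul] at h1
        rw [h3, ← r.mul_injective h1, Word.app_mul]
  · refine Or.inl ((hcongr ∅ fun γ => ?_).trans (Set.indicator_empty' _))
    refine iff_of_false (Set.notMem_empty γ) ?_
    rintro ⟨hl, hl', x, y, hxy, -⟩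
    exact h ⟨hl, hl', x, y, hxy⟩

/-! ### Countability and norm estimates -/

/-- The universal representation as a linear map. -/
def univRepLin (n : ℕ) :
    C_c(Gpd₀ n, ℂ) →ₗ[ℂ] lp (fun ρ : Rep n => ρ.H →L[ℂ] ρ.H) ∞ where
  toFun := univRep
  map_add' f g := Subtype.ext (funext fun ρ => map_add ρ.L f g)
  map_smul' c f := Subtype.ext (funext fun ρ => map_smul ρ.L c f)

theorem norm_univRepLin_le {f : C_c(Gpd₀ n, ℂ)} {ε : ℝ} (hε : 0 ≤ ε)
    (hf : iNorm ⇑f ≤ ENNReal.ofReal ε) : ‖univRepLin n f‖ ≤ ε := by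
  refine lp.norm_le_of_forall_le hε fun ρ => ?_
  have h := (ρ.bounded f).trans hf
  rw [← ofReal_norm] at h
  exact (ENNReal.ofReal_le_ofReal_iff hε).1 h

theorem univRep_mem_cstar (f : C_c(Gpd₀ n, ℂ)) : univRep f ∈ cstar n :=
  NonUnitalStarSubalgebra.le_topologicalClosure _ (NonUnitalStarAlgebra.subset_adjoin ℂ _ ⟨f, rfl⟩)

theorem exchangeClosed_univ : ExchangeClosed (Set.univ : Set (Word n)) :=
  fun _ _ _ _ _ _ _ => trivial

instance : Countable (Word n) := by
  have h1 : Countable (Lam n) := inferInstanceAs (Countable (Fin n → ℤ))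
  have h2 : Countable (Pos n) := Subtype.countable
  exact Subtype.countable

instance : Nonempty (Word n) := ⟨Word.nil⟩

/-- Each fibre of `π` meets each bisection in at most one point, so every bisection of the cover
contributes at most `C`. -/
theorem tsum_fibre_le_of_bound {f : Gpd₀ n → ℂ} {C : ℝ} (hC : ∀ γ, ‖f γ‖ ≤ C)
    {t : Finset (Word n × Word n)} (ht : ∀ γ, f γ ≠ 0 → ∃ i ∈ t, γ ∈ bis i.1 i.2)
    (π : Gpd₀ n → Bd n) (hπ : ∀ p q : Word n, Set.InjOn π (bis p q)) :
    (⨆ x : Bd n, ∑' γ : {γ : Gpd₀ n // π γ = x}, ‖f γ.1‖ₑ) ≤ t.card * ENNReal.ofReal C := by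
  classical
  have hle : ∀ γ, ‖f γ‖ₑ ≤ ∑ i ∈ t, if γ ∈ bis i.1 i.2 then ENNReal.ofReal C else 0 := fun γ => by
    by_cases h0 : f γ = 0
    · simp [h0]
    obtain ⟨i, hit, hi⟩ := ht γ h0
    refine le_trans ?_ (Finset.single_le_sum (fun _ _ => zero_le) hit)
    rw [if_pos hi, ← ofReal_norm]
    exact ENNReal.ofReal_le_ofReal (hC γ)
  refine iSup_le fun x => (ENNReal.tsum_le_tsum fun γ : {γ : Gpd₀ n // π γ = x} => hle γ.1).trans ?_
  rw [Summable.tsum_finsetSum fun _ _ => ENNReal.summable, ← nsmul_eq_mul, ← Finset.sum_const]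
  refine Finset.sum_le_sum fun i _ => ?_
  by_cases h : ∃ γ : {γ : Gpd₀ n // π γ = x}, γ.1 ∈ bis i.1 i.2
  · obtain ⟨γ, hγ⟩ := h
    rw [tsum_eq_single γ fun γ' hne => if_neg fun hγ' : γ'.1 ∈ bis i.1 i.2 =>
      hne (Subtype.ext (hπ i.1 i.2 hγ' hγ (γ'.2.trans γ.2.symm)))]
    exact (if_pos hγ).le
  · rw [ENNReal.tsum_eq_zero.2 fun γ => if_neg fun hγ => h ⟨γ, hγ⟩]
    exact zero_le

section NeZero

variable [NeZero n]

/-! ### Approximation by linear combinations of indicator functions -/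

/-- The indicator function of the compact open bisection `[p, q]`. -/
def bisIndicator (p q : Word n) : C_c(Gpd₀ n, ℂ) where
  toFun := (bis p q).indicator 1
  continuous_toFun := continuous_one.indicator fun γ hγ => by
    rw [IsClopen.frontier_eq ⟨isClosed_bis p q, isOpen_bis p q⟩] at hγ
    exact hγ.elim
  hasCompactSupport' := HasCompactSupport.intro' (isCompact_bis p q) (isClosed_bis p q)
    fun _ hγ => Set.indicator_of_notMem hγ _

theorem coe_bisIndicator (p q : Word n) : ⇑(bisIndicator p q) = (bis p q).indicator 1 := rfl

/-- The span of the indicator functions of the basic bisections. -/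
def indicatorSpan (n : ℕ) [NeZero n] : Submodule ℂ C_c(Gpd₀ n, ℂ) :=
  Submodule.span ℂ (Set.range fun pq : Word n × Word n => bisIndicator pq.1 pq.2)

theorem bisIndicator_mem (p q : Word n) : bisIndicator p q ∈ indicatorSpan n :=
  Submodule.subset_span ⟨(p, q), rfl⟩

/-- The product here is pointwise, not convolution: two basic bisections intersect in one of them or
not at all. -/
theorem mul_mem_indicatorSpan {f g : C_c(Gpd₀ n, ℂ)} (hf : f ∈ indicatorSpan n)
    (hg : g ∈ indicatorSpan n) : f * g ∈ indicatorSpan n := by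
  induction hf, hg using Submodule.span_induction₂ with
  | mem_mem f g hf hg =>
    obtain ⟨⟨p, q⟩, rfl⟩ := hf
    obtain ⟨⟨r, s⟩, rfl⟩ := hg
    have hmul : ⇑(bisIndicator p q * bisIndicator r s) = (bis p q ∩ bis r s).indicator 1 := by
      rw [CompactlySupportedContinuousMap.coe_mul, coe_bisIndicator, coe_bisIndicator]
      exact (Set.inter_indicator_one).symm
    rcases bis_trichotomy p q r s with ⟨t, rfl, rfl⟩ | ⟨t, rfl, rfl⟩ | h
    · rw [Set.inter_eq_right.2 (bis_app_subset p q t)] at hmul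
      rw [show _ * _ = bisIndicator _ _ from DFunLike.coe_injective hmul]
      exact bisIndicator_mem _ _
    · rw [Set.inter_eq_left.2 (bis_app_subset r s t)] at hmul
      rw [show _ * _ = bisIndicator _ _ from DFunLike.coe_injective hmul]
      exact bisIndicator_mem _ _
    · rw [h.inter_eq, Set.indicator_empty'] at hmul
      rw [show _ * _ = (0 : C_c(Gpd₀ n, ℂ)) from DFunLike.coe_injective hmul]
      exact zero_mem _
  | zero_left => rw [zero_mul]; exact zero_mem _
  | zero_right => rw [mul_zero]; exact zero_mem _
  | add_left f g h _ _ _ h1 h2 => rw [add_mul]; exact add_mem h1 h2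
  | add_right f g h _ _ _ h1 h2 => rw [mul_add]; exact add_mem h1 h2
  | smul_left c f g _ _ h => rw [smul_mul_assoc]; exact Submodule.smul_mem _ _ h
  | smul_right c f g _ _ h => rw [mul_smul_comm]; exact Submodule.smul_mem _ _ h

/-- The sets whose indicator functions are linear combinations of those of basic bisections. -/
def IsSimple (S : Set (Gpd₀ n)) : Prop := ∃ e ∈ indicatorSpan n, ⇑e = S.indicator 1

theorem isSimple_bis (p q : Word n) : IsSimple (bis p q) := ⟨_, bisIndicator_mem p q, rfl⟩

theorem isSimple_empty : IsSimple (∅ : Set (Gpd₀ n)) := ⟨0, zero_mem _, (Set.indicator_empty' _).symm⟩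

theorem IsSimple.inter {S T : Set (Gpd₀ n)} (hS : IsSimple S) (hT : IsSimple T) :
    IsSimple (S ∩ T) := by
  obtain ⟨e, he, heS⟩ := hS
  obtain ⟨f, hf, hfT⟩ := hT
  refine ⟨e * f, mul_mem_indicatorSpan he hf, ?_⟩
  rw [CompactlySupportedContinuousMap.coe_mul, heS, hfT]
  exact Set.inter_indicator_one.symm

theorem IsSimple.diff {S T : Set (Gpd₀ n)} (hS : IsSimple S) (hT : IsSimple T) :
    IsSimple (S \ T) := by
  classical
  obtain ⟨e, he, heS⟩ := hS
  obtain ⟨f, hf, hfT⟩ := hT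
  refine ⟨e - e * f, sub_mem he (mul_mem_indicatorSpan he hf), funext fun γ => ?_⟩
  simp only [CompactlySupportedContinuousMap.coe_sub, CompactlySupportedContinuousMap.coe_mul,
    Pi.sub_apply, Pi.mul_apply, heS, hfT, Set.indicator_apply, Pi.one_apply, Set.mem_sdiff]
  by_cases h1 : γ ∈ S <;> by_cases h2 : γ ∈ T <;> simp [h1, h2]

theorem IsSimple.union {S T : Set (Gpd₀ n)} (hS : IsSimple S) (hT : IsSimple T) :
    IsSimple (S ∪ T) := by
  classical
  obtain ⟨e, he, heS⟩ := hS
  obtain ⟨f, hf, hfT⟩ := hT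
  refine ⟨e + f - e * f, sub_mem (add_mem he hf) (mul_mem_indicatorSpan he hf),
    funext fun γ => ?_⟩
  simp only [CompactlySupportedContinuousMap.coe_sub, CompactlySupportedContinuousMap.coe_mul,
    CompactlySupportedContinuousMap.coe_add, Pi.add_apply,
    Pi.sub_apply, Pi.mul_apply, heS, hfT, Set.indicator_apply, Pi.one_apply, Set.mem_union]
  by_cases h1 : γ ∈ S <;> by_cases h2 : γ ∈ T <;> simp [h1, h2]

theorem IsSimple.isOpen {S : Set (Gpd₀ n)} (hS : IsSimple S) : IsOpen S := by
  classical
  obtain ⟨e, -, heS⟩ := hS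
  convert isOpen_ne.preimage e.continuous (t := {z : ℂ | z ≠ 0})
  ext γ
  simp [heS]

theorem exists_isSimple_subset {U : Set (Gpd n)} (hU : IsOpen U) (γ : Gpd₀ n) (hγ : γ.1 ∈ U) :
    ∃ S : Set (Gpd₀ n), IsSimple S ∧ γ ∈ S ∧ S ⊆ Subtype.val ⁻¹' U := by
  induction hU with
  | basic U hU =>
    obtain ⟨p, q, A, ⟨t, rfl⟩ | ⟨t, u, rfl⟩, rfl⟩ := hU
    · exact ⟨_, by rw [preimage_bisection_V]; exact isSimple_bis _ _, hγ, subset_rfl⟩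
    · refine ⟨_, ?_, hγ, subset_rfl⟩
      rw [preimage_bisection_diff, preimage_bisection_V, preimage_bisection_V]
      exact (isSimple_bis _ _).diff (isSimple_bis _ _)
  | univ =>
    obtain ⟨p, q, h⟩ := exists_mem_bis γ
    exact ⟨_, isSimple_bis p q, h, fun _ _ => trivial⟩
  | inter U T _ _ h1 h2 =>
    obtain ⟨S, hS, hγS, hSU⟩ := h1 hγ.1
    obtain ⟨S', hS', hγS', hSU'⟩ := h2 hγ.2
    exact ⟨_, hS.inter hS', ⟨hγS, hγS'⟩, fun δ hδ => ⟨hSU hδ.1, hSU' hδ.2⟩⟩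
  | sUnion 𝒰 _ ih =>
    obtain ⟨U, hU, hγU⟩ := hγ
    obtain ⟨S, hS, hγS, hSU⟩ := ih U hU hγU
    exact ⟨S, hS, hγS, fun δ hδ => ⟨U, hU, hSU hδ⟩⟩

/-- Uniform approximation on a simple neighbourhood of a compact set by a linear combination of
indicator functions. -/
theorem exists_simple_approx (f : C_c(Gpd₀ n, ℂ)) {ε : ℝ} (hε : 0 < ε) {K : Set (Gpd₀ n)}
    (hK : IsCompact K) : ∃ S, IsSimple S ∧ K ⊆ S ∧ ∃ g ∈ indicatorSpan n, ∀ γ ∈ S,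
      ‖f γ - g γ‖ ≤ ε := by
  classical
  refine hK.induction_on (p := fun K => ∃ S, IsSimple S ∧ K ⊆ S ∧ ∃ g ∈ indicatorSpan n,
    ∀ γ ∈ S, ‖f γ - g γ‖ ≤ ε) ⟨∅, isSimple_empty, subset_rfl, 0, zero_mem _, by simp⟩
    (fun S T hST ⟨S', h1, h2, h3⟩ => ⟨S', h1, hST.trans h2, h3⟩) ?_ fun γ _ => ?_
  · rintro _ _ ⟨S, hS, hKS, g, hg, hfg⟩ ⟨T, hT, hKT, h, hh, hfh⟩
    refine ⟨S ∪ T, hS.union hT, Set.union_subset_union hKS hKT, ?_⟩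
    obtain ⟨e, he, heS⟩ := hS
    -- Patching: this function equals `g` on `S` and `h` off `S`.
    refine ⟨g * e + (h - h * e), add_mem (mul_mem_indicatorSpan hg he)
      (sub_mem hh (mul_mem_indicatorSpan hh he)), fun γ hγ => ?_⟩
    by_cases hγS : γ ∈ S
    · simpa [heS, hγS] using hfg γ hγS
    · simpa [heS, hγS] using hfh γ (hγ.resolve_left hγS)
  · have hopen : IsOpen {δ : Gpd₀ n | ‖f δ - f γ‖ < ε} :=
      isOpen_lt (by fun_prop) continuous_const
    obtain ⟨U, hU, hUeq⟩ := isOpen_induced_iff.1 hopen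
    have hγU : γ ∈ Subtype.val ⁻¹' U := by
      rw [hUeq]
      simpa using hε
    obtain ⟨S, hS, hγS, hSU⟩ := exists_isSimple_subset hU γ hγU
    refine ⟨S, mem_nhdsWithin_of_mem_nhds (hS.isOpen.mem_nhds hγS), S, hS, subset_rfl, ?_⟩
    obtain ⟨e, he, heS⟩ := hS
    refine ⟨f γ • e, Submodule.smul_mem _ _ he, fun δ hδ => ?_⟩
    have h1 : δ ∈ {δ : Gpd₀ n | ‖f δ - f γ‖ < ε} := hUeq ▸ hSU hδ
    have h2 : ‖f δ - f γ‖ < ε := h1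
    simpa [heS, hδ] using h2.le

theorem exists_iNorm_approx (f : C_c(Gpd₀ n, ℂ)) {ε : ℝ} (hε : 0 < ε) :
    ∃ g ∈ indicatorSpan n, iNorm ⇑(f - g) ≤ ENNReal.ofReal ε := by
  classical
  obtain ⟨t, ht⟩ := f.hasCompactSupport.elim_finite_subcover
    (fun i : Word n × Word n => bis i.1 i.2) (fun i => isOpen_bis i.1 i.2) fun γ _ => by
      obtain ⟨p, q, h⟩ := exists_mem_bis γ
      exact Set.mem_iUnion.2 ⟨(p, q), h⟩
  have hKs : IsSimple (⋃ i ∈ t, bis i.1 i.2) := by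
    clear ht
    induction t using Finset.induction_on with
    | empty => simpa using isSimple_empty
    | insert i t _ ih =>
      rw [Finset.set_biUnion_insert]
      exact (isSimple_bis _ _).union ih
  -- The summand `1` keeps the tolerance positive when the cover is empty.
  have hδ : 0 < ε / (t.card + 1) := by positivity
  obtain ⟨S, -, hKS, g, hg, hfg⟩ := exists_simple_approx f hδ
    (t.isCompact_biUnion fun i _ => isCompact_bis i.1 i.2)
  obtain ⟨e, he, heK⟩ := hKs
  have hval : ∀ γ, γ ∉ ⋃ i ∈ t, bis i.1 i.2 → (f - g * e) γ = 0 := fun γ hγ => by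
    have hfγ : f γ = 0 := by
      by_contra h
      exact hγ (ht (subset_tsupport f h))
    simp [heK, hγ, hfγ]
  have hbound : ∀ γ, ‖(f - g * e) γ‖ ≤ ε / (t.card + 1) := fun γ => by
    by_cases hγ : γ ∈ ⋃ i ∈ t, bis i.1 i.2
    · have h1 : (f - g * e) γ = f γ - g γ := by
        rw [CompactlySupportedContinuousMap.sub_apply, CompactlySupportedContinuousMap.mul_apply,
          heK, Set.indicator_of_mem hγ, Pi.one_apply, mul_one]
      rw [h1]
      exact hfg γ (hKS hγ)
    · rw [hval γ hγ, norm_zero]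
      exact hδ.le
  have hsupp : ∀ γ, (f - g * e) γ ≠ 0 → ∃ i ∈ t, γ ∈ bis i.1 i.2 := fun γ hγ => by
    have := not_imp_comm.1 (hval γ) hγ
    simpa using this
  have hfin : (t.card : ℝ≥0∞) * ENNReal.ofReal (ε / (t.card + 1)) ≤ ENNReal.ofReal ε := by
    rw [← ENNReal.ofReal_natCast, ← ENNReal.ofReal_mul (Nat.cast_nonneg _)]
    refine ENNReal.ofReal_le_ofReal ?_
    rw [mul_div_assoc', div_le_iff₀ (by positivity)]
    nlinarith
  -- Multiplying by the indicator `e` of the covered set confines the error to the bisections of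
  -- `t`, so that they can be counted.
  exact ⟨g * e, mul_mem_indicatorSpan hg he,
    max_le ((tsum_fibre_le_of_bound hbound hsupp _ injOn_rng_bis).trans hfin)
      ((tsum_fibre_le_of_bound hbound hsupp _ injOn_src_bis).trans hfin)⟩

/-! ### The finite-dimensional subalgebras -/

/-- The image of the indicator function of `[p, q]` in the universal representation. -/
def unit (p q : Word n) : lp (fun ρ : Rep n => ρ.H →L[ℂ] ρ.H) ∞ := univRepLin n (bisIndicator p q)

theorem star_unit (p q : Word n) : star (unit p q) = unit q p := by
  classical
  refine Subtype.ext (funext fun ρ => (ρ.map_invol _ _ (funext fun γ => ?_)).symm)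
  rw [coe_bisIndicator, coe_bisIndicator, invol, Set.indicator_apply, Set.indicator_apply]
  simp only [inv₀_mem_bis]
  split_ifs <;> simp

theorem unit_mul_unit {F : Set (Word n)} (hF : ExchangeClosed F) {p q r s : Word n}
    (hp : p ∈ F) (hq : q ∈ F) (hr : r ∈ F) (hs : s ∈ F) :
    unit p q * unit r s = 0 ∨ ∃ p' ∈ F, ∃ s' ∈ F, unit p q * unit r s = unit p' s' := by
  have hmul : ∀ h : C_c(Gpd₀ n, ℂ), ⇑h = conv (bisIndicator p q) (bisIndicator r s) →
      unit p q * unit r s = univRepLin n h := fun h hh =>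
    Subtype.ext (funext fun ρ => (ρ.map_conv _ _ _ hh).symm)
  rcases exists_conv_bis hF hp hq hr hs with h | ⟨p', hp', s', hs', h⟩
  · exact Or.inl ((hmul 0 h.symm).trans (map_zero _))
  · exact Or.inr ⟨p', hp', s', hs', hmul (bisIndicator p' s') h.symm⟩

/-- The span of a self-adjoint family which is multiplicatively closed up to linear
combinations. -/
def starSpan {A : Type*} [NonUnitalRing A] [StarRing A] [Module ℂ A] [IsScalarTower ℂ A A]
    [SMulCommClass ℂ A A] [StarModule ℂ A] (G : Set A)
    (hmul : ∀ a ∈ G, ∀ b ∈ G, a * b ∈ Submodule.span ℂ G) (hstar : ∀ a ∈ G, star a ∈ G) :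
    NonUnitalStarSubalgebra ℂ A where
  __ := Submodule.span ℂ G
  mul_mem' {a b} ha hb := by
    change a ∈ Submodule.span ℂ G at ha
    change b ∈ Submodule.span ℂ G at hb
    change a * b ∈ Submodule.span ℂ G
    induction ha, hb using Submodule.span_induction₂ with
    | mem_mem a b ha hb => exact hmul a ha b hb
    | zero_left => rw [zero_mul]; exact zero_mem _
    | zero_right => rw [mul_zero]; exact zero_mem _
    | add_left f g h _ _ _ h1 h2 => rw [add_mul]; exact add_mem h1 h2
    | add_right f g h _ _ _ h1 h2 => rw [mul_add]; exact add_mem h1 h2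
    | smul_left c f g _ _ h => rw [smul_mul_assoc]; exact Submodule.smul_mem _ _ h
    | smul_right c f g _ _ h => rw [mul_smul_comm]; exact Submodule.smul_mem _ _ h
  star_mem' {a} ha := by
    change a ∈ Submodule.span ℂ G at ha
    change star a ∈ Submodule.span ℂ G
    induction ha using Submodule.span_induction with
    | mem a ha => exact Submodule.subset_span (hstar a ha)
    | zero => rw [star_zero]; exact zero_mem _
    | add a b _ _ h1 h2 => rw [star_add]; exact add_mem h1 h2
    | smul c a _ h => rw [star_smul]; exact Submodule.smul_mem _ _ h

theorem mem_starSpan {A : Type*} [NonUnitalRing A] [StarRing A] [Module ℂ A] [IsScalarTower ℂ A A]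
    [SMulCommClass ℂ A A] [StarModule ℂ A] {G : Set A}
    {hmul : ∀ a ∈ G, ∀ b ∈ G, a * b ∈ Submodule.span ℂ G} {hstar : ∀ a ∈ G, star a ∈ G} {a : A} :
    a ∈ starSpan G hmul hstar ↔ a ∈ Submodule.span ℂ G := Iff.rfl

theorem finiteDimensional_starSpan {A : Type*} [NonUnitalRing A] [StarRing A] [Module ℂ A]
    [IsScalarTower ℂ A A] [SMulCommClass ℂ A A] [StarModule ℂ A] {G : Set A}
    {hmul : ∀ a ∈ G, ∀ b ∈ G, a * b ∈ Submodule.span ℂ G} {hstar : ∀ a ∈ G, star a ∈ G}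
    (hG : G.Finite) : FiniteDimensional ℂ (starSpan G hmul hstar) :=
  FiniteDimensional.span_of_finite ℂ hG

theorem isAF_of_subset_closure {B : Type*} [NonUnitalCStarAlgebra B]
    (C : NonUnitalStarSubalgebra ℂ B) [IsClosed (C : Set B)]
    (F : ℕ → NonUnitalStarSubalgebra ℂ B) (hF : Monotone F) (hFC : ∀ m, F m ≤ C)
    (hfin : ∀ m, FiniteDimensional ℂ (F m)) (hC : (C : Set B) ⊆ closure (⋃ m, (F m : Set B))) :
    IsAF C := by
  refine ⟨fun m => (F m).comap (NonUnitalStarSubalgebraClass.subtype C),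
    fun m m' h a ha => hF h ha, fun m => ?_, fun a => ?_⟩
  · let φ : (F m).comap (NonUnitalStarSubalgebraClass.subtype C) →ₗ[ℂ] F m :=
      { toFun := fun a => ⟨a.1.1, a.2⟩
        map_add' := fun _ _ => rfl
        map_smul' := fun _ _ => rfl }
    have := hfin m
    refine FiniteDimensional.of_injective φ fun a b h => Subtype.ext (Subtype.ext ?_)
    exact congrArg (Subtype.val : F m → B) h
  · rw [Topology.IsInducing.subtypeVal.closure_eq_preimage_closure_image]
    refine closure_mono (fun b hb => ?_) (hC a.2)
    obtain ⟨m, hm⟩ := Set.mem_iUnion.1 hb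
    exact ⟨⟨b, hFC m hm⟩, Set.mem_iUnion.2 ⟨m, hm⟩, rfl⟩

/-- The matrix units of a set of words. -/
def units (F : Set (Word n)) : Set (lp (fun ρ : Rep n => ρ.H →L[ℂ] ρ.H) ∞) :=
  Set.image2 unit F F

theorem mul_mem_span_units {F : Set (Word n)} (hF : ExchangeClosed F) :
    ∀ a ∈ units F, ∀ b ∈ units F, a * b ∈ Submodule.span ℂ (units F) := by
  rintro _ ⟨p, hp, q, hq, rfl⟩ _ ⟨r, hr, s, hs, rfl⟩
  rcases unit_mul_unit hF hp hq hr hs with h | ⟨p', hp', s', hs', h⟩ <;> rw [h]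
  · exact zero_mem _
  · exact Submodule.subset_span ⟨p', hp', s', hs', rfl⟩

theorem star_mem_units {F : Set (Word n)} : ∀ a ∈ units F, star a ∈ units F := by
  rintro _ ⟨p, hp, q, hq, rfl⟩
  exact ⟨q, hq, p, hp, (star_unit p q).symm⟩

/-- The algebra spanned by the matrix units of an exchange-closed set of words. -/
def unitsAlg (F : Set (Word n)) (hF : ExchangeClosed F) :
    NonUnitalStarSubalgebra ℂ (lp (fun ρ : Rep n => ρ.H →L[ℂ] ρ.H) ∞) :=
  starSpan (units F) (mul_mem_span_units hF) star_mem_units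

theorem unitsAlg_le_cstar (F : Set (Word n)) (hF : ExchangeClosed F) :
    unitsAlg F hF ≤ cstar n := fun a ha => by
  refine Submodule.span_le (p := (cstar n).toNonUnitalSubalgebra.toSubmodule).2 ?_
    (mem_starSpan.1 ha)
  rintro _ ⟨p, _, q, _, rfl⟩
  exact univRep_mem_cstar _

/-- The set of all words is exchange-closed, so its units span a `*`-algebra; it then suffices to
approximate the generators `univRep f`. -/
theorem cstar_le_closure_unitsAlg :
    cstar n ≤ (unitsAlg (Set.univ : Set (Word n)) exchangeClosed_univ).topologicalClosure := by
  refine NonUnitalStarSubalgebra.topologicalClosure_minimal _ (NonUnitalStarAlgebra.adjoin_le ?_)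
    (NonUnitalStarSubalgebra.isClosed_topologicalClosure _)
  rintro _ ⟨f, rfl⟩
  refine Metric.mem_closure_iff.2 fun ε hε => ?_
  obtain ⟨g, hg, hfg⟩ := exists_iNorm_approx f (half_pos hε)
  refine ⟨univRepLin n g, ?_, ?_⟩
  · have h1 : univRepLin n g ∈ (indicatorSpan n).map (univRepLin n) := ⟨g, hg, rfl⟩
    rw [indicatorSpan, Submodule.map_span] at h1
    refine Submodule.span_mono ?_ h1
    rintro _ ⟨_, ⟨⟨p, q⟩, rfl⟩, rfl⟩
    exact ⟨p, trivial, q, trivial, rfl⟩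
  · have h1 : dist (univRepLin n f) (univRepLin n g) ≤ ε / 2 := by
      rw [dist_eq_norm, ← map_sub]
      exact norm_univRepLin_le (half_pos hε).le hfg
    exact h1.trans_lt (half_lt_self hε)

theorem exists_exhaustion (n : ℕ) [NeZero n] : ∃ F : ℕ → Finset (Word n), Monotone F ∧
    (∀ m, ExchangeClosed (F m : Set (Word n))) ∧ ∀ p, ∃ m, p ∈ F m := by
  classical
  obtain ⟨w, hw⟩ := exists_surjective_nat (Word n)
  choose c hc hc' using fun F : Finset (Word n) => exists_exchangeClosed F
  let F : ℕ → Finset (Word n) := fun m => Nat.rec (c ∅) (fun m F => c (insert (w m) F)) m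
  refine ⟨F, monotone_nat_of_le_succ fun m => (Finset.subset_insert _ _).trans (hc _),
    fun m => by cases m <;> exact hc' _, fun p => ?_⟩
  obtain ⟨m, rfl⟩ := hw p
  exact ⟨m + 1, hc _ (Finset.mem_insert_self _ _)⟩

theorem isAF_cstar (n : ℕ) [NeZero n] : IsAF (cstar n) := by
  obtain ⟨F, hmono, hF, hex⟩ := exists_exhaustion n
  have hunits : Monotone fun m => units (F m : Set (Word n)) := fun m m' h =>
    Set.image2_subset (hmono h) (hmono h)
  have hunion : units (Set.univ : Set (Word n)) ⊆ ⋃ m, units (F m : Set (Word n)) := by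
    rintro _ ⟨p, -, q, -, rfl⟩
    obtain ⟨k, hk⟩ := hex p
    obtain ⟨m, hm⟩ := hex q
    exact Set.mem_iUnion.2 ⟨max k m, p, hmono (le_max_left _ _) hk, q,
      hmono (le_max_right _ _) hm, rfl⟩
  refine isAF_of_subset_closure (cstar n) (fun m => unitsAlg (F m : Set (Word n)) (hF m))
    (fun m m' h => Submodule.span_mono (hunits h)) (fun m => unitsAlg_le_cstar _ _)
    (fun m => finiteDimensional_starSpan ((F m).finite_toSet.image2 _ (F m).finite_toSet))
    fun a ha => closure_mono (fun b hb => ?_) (cstar_le_closure_unitsAlg ha)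
  have h1 := Submodule.span_mono hunion (mem_starSpan.1 hb)
  -- The spans increase with `m`, so an element of the span of all units already lies in one stage.
  rw [Submodule.span_iUnion, Submodule.mem_iSup_of_directed _ (Monotone.directed_le
    fun m m' h => Submodule.span_mono (hunits h))] at h1
  exact Set.mem_iUnion.2 h1

end NeZero

end ZnTree

end

theorem mainTheorem2 (n : ℕ) (hn : 2 ≤ n) : ZnTree.IsAF (ZnTree.cstar n) :=
  haveI : NeZero n := ⟨by omega⟩
  ZnTree.isAF_cstar n
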